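/- **Conventions.** Filtrations are indexed by the non-positive integers $\mathbb Z_-=\{n\in\mathbb Z: n\le 0\}$ or by an infinite subset $D$ of $\mathbb Z_-$; all sub-$\sigma$-fields of a probability space are taken complete and essentially separable, and $\mathcal F^Z_n=\sigma(Z_k: k\le n)$ (completed). A filtration is *of product type* if it is the natural filtration of a process of independent random variables. $\mathcal F$ is *immersed* into $\mathcal G$ if for every $n$, $\mathcal F_n\subset\mathcal G_n$ and $\mathcal F_n$ is independent of $\mathcal G_{m}$ conditionally on $\mathcal F_{m}$, where $m$ is the predecessor of $n$ in the index set (equivalently, for all $m\le n$ in the index set). An *isomorphism* between filtered probability spaces is a bijection from $L^0(\mathcal F_\infty)$ onto $L^0(\mathcal F'_\infty)$ which preserves laws, commutes with Borel functions of sequences of random variables, and sends $\mathcal F$ on $\mathcal F'$. A filtration is *standard* if some isomorphic copy of it, on some probability space, is immersed into a product-type filtration. A filtration $(\mathcal F_n)_{n\le 0}$ is *at the threshold of standardness* if it is not standard and, for every infinite $B\subset\mathbb Z_-$, $(\mathcal F_n)_{n\in B}$ is standard if and only if $\mathbb Z_-\setminus B$ is infinite. It is *$(r_n)_{n\le 0}$-adic*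 if for every $n\le 0$, $\mathcal F_n$ is generated by $\mathcal F_{n-1}$ and a random variable independent of $\mathcal F_{n-1}$ and uniform on a set of $r_n$ elements. A triple $(Z_0,Z_1,Z_2)$ of random variables, uniform on finite sets $F_0,F_1,F_2$, is a *strong $(r_1,r_2)$-adic $\alpha$-brick* (with $r_1,r_2$ positive integers) if: $Z_0$ and $Z_2$ are independent; $Z_1$ is almost surely a deterministic function of $(Z_0,Z_2)$; $Z_0$ is almost surely a deterministic function of $Z_1$; the conditional law of $Z_1$ given $Z_0$ (respectively of $Z_2$ given $Z_1$) is uniform on a random set of size $r_1$ (respectively $r_2$); and for all distinct $z',z''\in F_1$, $$\sum_{z\in F_2}\min\big(\mathbb P[Z_2=z\mid Z_1=z'],\ \mathbb P[Z_2=z\mid Z_1=z'']\big)\le\alpha .$$ **Theorem.** Let $(\alpha_n)_{n\le 0}$ be a sequence in $]0,1[$ such that $\sum_{n\le 0}\alpha_n<\infty$, let $(r_n)_{n\le 0}$ be a sequence of positive integers, and let $(Z_n)_{n\le 0}$ be random variables on a probability space with values in finite sets $(F_n)_{n\le 0}$ of size at least $2$. Assume that the random variables $(Z_{2n})_{n\le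 0}$ are independent and that for each $n\le 0$, $(Z_{2n-2},Z_{2n-1},Z_{2n})$ is a strong $(r_{2n-1},r_{2n})$-adic $\alpha_n$-brick. Then: 1. $(Z_n)_{n\le 0}$ is an (inhomogeneous) Markov process and its natural filtration $\mathcal F^Z$ is $(r_n)_{n\le 0}$-adic; 2. for every infinite subset $D$ of $\mathbb Z_-$, the filtration $(\mathcal F^Z_n)_{n\in D}$ is standard if and only if $2n-1\notin D$ for infinitely many $n\le 0$; 3. in particular, $(\mathcal F^Z_{2n-1})_{n\le 0}$ is at the threshold of standardness. -/

import Mathlib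

open MeasureTheory ProbabilityTheory Filter Set

noncomputable section

namespace BackwardFiltration

universe u

/-- The completion of a sub-σ-field `m` inside the probability space `(Ω, mΩ, μ)`: the events of
`mΩ` that are almost surely equal to an event of `m`. -/
@[reducible] def completed {Ω : Type*} {mΩ : MeasurableSpace Ω} (μ : Measure Ω) (m : MeasurableSpace Ω) :
    MeasurableSpace Ω :=
  eventuallyMeasurableSpace m (ae μ) ⊓ mΩ

theorem completed_mono {Ω : Type*} {mΩ : MeasurableSpace Ω} (μ : Measure Ω)
    {m₁ m₂ : MeasurableSpace Ω} (h : m₁ ≤ m₂) : completed μ m₁ ≤ completed μ m₂ := by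
  refine inf_le_inf_right _ ?_
  rintro s ⟨t, ht, hst⟩
  exact ⟨t, h t ht, hst⟩

/-- The (completed) natural filtration `n ↦ σ(Z k : k ≤ n)` of a process `Z`. -/
def naturalFiltration {Ω ι : Type*} [Preorder ι] {mΩ : MeasurableSpace Ω} (μ : Measure Ω)
    {E : ι → Type*} [∀ n, MeasurableSpace (E n)] (Z : ∀ n, Ω → E n) : Filtration ι mΩ where
  seq n := completed μ (⨆ k : Set.Iic n, MeasurableSpace.comap (Z k) inferInstance)
  mono' _ _ hmn := completed_mono μ <| iSup_le fun k =>
    le_iSup_of_le (⟨k.1, k.2.trans hmn⟩ : Set.Iic _) le_rfl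
  le' _ := inf_le_right

/-- The filtration `i ↦ ℱ (φ i)` obtained from `ℱ` by a monotone change of time `φ`. -/
def reindex {Ω ι κ : Type*} [Preorder ι] [Preorder κ] {mΩ : MeasurableSpace Ω}
    (ℱ : Filtration ι mΩ) (φ : κ → ι) (hφ : Monotone φ) : Filtration κ mΩ where
  seq i := ℱ (φ i)
  mono' _ _ hij := ℱ.mono (hφ hij)
  le' i := ℱ.le (φ i)

/-- The extracted filtration `(ℱ n)_{n ∈ D}`. -/
def extract {Ω ι : Type*} [Preorder ι] {mΩ : MeasurableSpace Ω}
    (ℱ : Filtration ι mΩ) (D : Set ι) : Filtration D mΩ :=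
  reindex ℱ (fun n : D => (n : ι)) (fun _ _ h => h)

/-- The filtration `(ℱ (2n-1))_{n ≤ 0}` extracted at the odd negative times. -/
def oddTimes {Ω : Type*} {mΩ : MeasurableSpace Ω} (ℱ : Filtration ℤ mΩ) :
    Filtration (Set.Iic (0 : ℤ)) mΩ :=
  reindex ℱ (fun n : Set.Iic (0 : ℤ) => 2 * (n : ℤ) - 1) (fun a b h => by
    have h' : (a : ℤ) ≤ b := h
    show 2 * (a : ℤ) - 1 ≤ 2 * (b : ℤ) - 1
    omega)

/-- A filtration is of product type if it is the natural filtration of a process of independent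
random variables. (Real-valued random variables generate all essentially separable σ-fields.) -/
def IsProductType {Ω ι : Type*} [Preorder ι] {mΩ : MeasurableSpace Ω} (μ : Measure Ω)
    (𝒢 : Filtration ι mΩ) : Prop :=
  ∃ V : ι → Ω → ℝ, (∀ n, Measurable (V n)) ∧ iIndepFun V μ ∧ 𝒢 = naturalFiltration μ V

/-- `ℱ` is immersed into `𝒢`: `ℱ n ⊆ 𝒢 n` for every `n`, and for `m ≤ n` the σ-fields `ℱ n` and
`𝒢 m` are independent conditionally on `ℱ m`. (In discrete time it is equivalent to require this
only when `m` is the predecessor of `n`.) -/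
def Immersed {Ω ι : Type*} [Preorder ι] {mΩ : MeasurableSpace Ω} (μ : Measure Ω)
    (ℱ 𝒢 : Filtration ι mΩ) : Prop :=
  (∀ n, ℱ n ≤ 𝒢 n) ∧
    ∀ m n, m ≤ n → ∀ A B : Set Ω, MeasurableSet[ℱ n] A → MeasurableSet[𝒢 m] B →
      μ[(A ∩ B).indicator (fun _ => (1 : ℝ)) | ℱ m] =ᵐ[μ]
        μ[A.indicator (fun _ => (1 : ℝ)) | ℱ m] * μ[B.indicator (fun _ => (1 : ℝ)) | ℱ m]

/-- `L⁰(Ω, m, μ)`: the classes modulo `μ` of the `m`-measurable real random variables. -/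
def L0 {Ω : Type*} {mΩ : MeasurableSpace Ω} (μ : Measure Ω) :
    MeasurableSpace Ω → Set (Ω →ₘ[μ] ℝ) :=
  fun m => {X | AEStronglyMeasurable[m] X μ}

/-- Isomorphisms of filtered probability spaces: bijections from `L⁰(ℱ_∞)` onto `L⁰(ℱ'_∞)` which
preserve the laws, commute with Borel functions of sequences of random variables, and send `ℱ`
on `ℱ'`. -/
structure FilteredIso {Ω Ω' ι : Type*} [Preorder ι] {mΩ : MeasurableSpace Ω}
    {mΩ' : MeasurableSpace Ω'} (μ : Measure Ω) (ℱ : Filtration ι mΩ)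
    (μ' : Measure Ω') (ℱ' : Filtration ι mΩ') where
  toEquiv : L0 μ (⨆ n, ℱ n) ≃ L0 μ' (⨆ n, ℱ' n)
  map_law : ∀ X, μ'.map ((toEquiv X : Ω' →ₘ[μ'] ℝ) : Ω' → ℝ) = μ.map ((X : Ω →ₘ[μ] ℝ) : Ω → ℝ)
  map_borel : ∀ (X : ℕ → L0 μ (⨆ n, ℱ n)) (Y : L0 μ (⨆ n, ℱ n)) (g : (ℕ → ℝ) → ℝ), Measurable g →
    (Y : Ω →ₘ[μ] ℝ) =ᵐ[μ] (fun ω => g fun k => (X k : Ω →ₘ[μ] ℝ) ω) →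
    (toEquiv Y : Ω' →ₘ[μ'] ℝ) =ᵐ[μ'] (fun ω => g fun k => (toEquiv (X k) : Ω' →ₘ[μ'] ℝ) ω)
  map_filtration : ∀ n X, (toEquiv X : Ω' →ₘ[μ'] ℝ) ∈ L0 μ' (ℱ' n) ↔
    (X : Ω →ₘ[μ] ℝ) ∈ L0 μ (ℱ n)

/-- A filtration is standard if it is immersible into a product-type filtration: some filtration
isomorphic to it, on some probability space, is immersed into a product-type filtration. -/
def IsStandard {Ω : Type u} {ι : Type*} [Preorder ι] {mΩ : MeasurableSpace Ω} (μ : Measure Ω)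
    (ℱ : Filtration ι mΩ) : Prop :=
  ∃ (Ω' : Type u) (mΩ' : MeasurableSpace Ω') (μ' : Measure Ω') (ℱ' 𝒢 : Filtration ι mΩ'),
    IsProbabilityMeasure μ' ∧ IsProductType μ' 𝒢 ∧ Nonempty (FilteredIso μ ℱ μ' ℱ') ∧
      Immersed μ' ℱ' 𝒢

/-- A filtration indexed by the non-positive integers is at the threshold of standardness if it is
not standard, and its infinite extractions are standard exactly when infinitely many times are
skipped. -/
def AtThreshold {Ω : Type*} {mΩ : MeasurableSpace Ω} (μ : Measure Ω)
    (ℱ : Filtration (Set.Iic (0 : ℤ)) mΩ) : Prop :=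
  ¬ IsStandard μ ℱ ∧
    ∀ B : Set (Set.Iic (0 : ℤ)), B.Infinite → (IsStandard μ (extract ℱ B) ↔ Bᶜ.Infinite)

/-- `(ℱ n)_{n ≤ 0}` is `(r n)`-adic: for every `n ≤ 0`, `ℱ n` is generated by `ℱ (n-1)` and a
random variable which is independent of `ℱ (n-1)` and uniform on a set with `r n` elements. -/
def IsAdicFiltration {Ω : Type*} {mΩ : MeasurableSpace Ω} (μ : Measure Ω) (ℱ : Filtration ℤ mΩ)
    (r : ℤ → ℕ) : Prop :=
  ∀ n ≤ 0, ∃ U : Ω → Fin (r n), Measurable U ∧ (∀ i, μ.real (U ⁻¹' {i}) = 1 / (r n : ℝ)) ∧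
    Indep (ℱ (n - 1)) (MeasurableSpace.comap U inferInstance) μ ∧
    ℱ n = completed μ (ℱ (n - 1) ⊔ MeasurableSpace.comap U inferInstance)

/-- `(Z n)_{n ≤ 0}` is an (inhomogeneous) Markov process: for every `n ≤ 0`, the conditional law of
`Z n` given the past up to time `n - 1` is its conditional law given `Z (n-1)`. -/
def IsMarkov {Ω : Type*} {mΩ : MeasurableSpace Ω} (μ : Measure Ω)
    {E : ℤ → Type*} [∀ n, MeasurableSpace (E n)] (Z : ∀ n, Ω → E n) : Prop :=
  ∀ n ≤ 0, ∀ A : Set (E n), MeasurableSet A →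
    μ[(Z n ⁻¹' A).indicator (fun _ => (1 : ℝ)) | naturalFiltration μ Z (n - 1)] =ᵐ[μ]
      μ[(Z n ⁻¹' A).indicator (fun _ => (1 : ℝ)) |
        MeasurableSpace.comap (Z (n - 1)) inferInstance]

/-- The random variable `Z` is uniform on the finite set `E`. -/
def IsUniform {Ω : Type*} {mΩ : MeasurableSpace Ω} (μ : Measure Ω) {E : Type*} [Fintype E]
    (Z : Ω → E) : Prop :=
  ∀ z, μ.real (Z ⁻¹' {z}) = 1 / (Fintype.card E : ℝ)

/-- The conditional probability `P[Y = y | X = x]`. -/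
def condProb {Ω : Type*} {mΩ : MeasurableSpace Ω} (μ : Measure Ω) {E E' : Type*}
    (Y : Ω → E') (X : Ω → E) (y : E') (x : E) : ℝ :=
  (μ[|X ⁻¹' {x}]).real (Y ⁻¹' {y})

/-- The conditional law of `Y` given `X` is uniform on a (random) set of size `r`. -/
def CondUniform {Ω : Type*} {mΩ : MeasurableSpace Ω} (μ : Measure Ω) {E E' : Type*}
    (Y : Ω → E') (X : Ω → E) (r : ℕ) : Prop :=
  ∃ S : E → Finset E', ∀ x, (S x).card = r ∧
    (∀ y ∈ S x, condProb μ Y X y x = 1 / (r : ℝ)) ∧ ∀ y ∉ S x, condProb μ Y X y x = 0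

/-- `(Z₀, Z₁, Z₂)` is a strong `(r₁, r₂)`-adic `α`-brick. -/
structure IsStrongBrick {Ω : Type*} {mΩ : MeasurableSpace Ω} (μ : Measure Ω)
    {E₀ E₁ E₂ : Type*} [Fintype E₀] [Fintype E₁] [Fintype E₂]
    [MeasurableSpace E₀] [MeasurableSpace E₁] [MeasurableSpace E₂]
    (Z₀ : Ω → E₀) (Z₁ : Ω → E₁) (Z₂ : Ω → E₂) (r₁ r₂ : ℕ) (α : ℝ) : Prop where
  pos₁ : 0 < r₁
  pos₂ : 0 < r₂
  uniform₀ : IsUniform μ Z₀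
  uniform₁ : IsUniform μ Z₁
  uniform₂ : IsUniform μ Z₂
  indep : IndepFun Z₀ Z₂ μ
  eq_fun₁ : ∃ g : E₀ → E₂ → E₁, ∀ᵐ ω ∂μ, Z₁ ω = g (Z₀ ω) (Z₂ ω)
  eq_fun₀ : ∃ f : E₁ → E₀, ∀ᵐ ω ∂μ, Z₀ ω = f (Z₁ ω)
  cond₁ : CondUniform μ Z₁ Z₀ r₁
  cond₂ : CondUniform μ Z₂ Z₁ r₂
  overlap : ∀ z' z'' : E₁, z' ≠ z'' →
    ∑ z : E₂, min (condProb μ Z₂ Z₁ z z') (condProb μ Z₂ Z₁ z z'') ≤ α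

end BackwardFiltration

end

/-!
Suppose that infinitely many odd times `2n - 1` are skipped. After each of them one can restart
from `Z (2n)`, which is independent of the past up to time `2n - 2`, and recover `Z (2n - 1)` from
its two neighbours. Between two restarts every `Z k` is determined by `Z (k - 1)` and a uniform
innovation. The restarting values and the innovations are independent, and as restarts occur
arbitrarily far in the past they generate the observed filtration, which is thus of product type.

Suppose now that only finitely many odd times are skipped and that the filtration is immersed in
the natural filtration of independent variables `V`. Couple two copies of `V` whose pasts up to a
remote time `m` are independent and which coincide afterwards. At remote times the two copies of
the chain are independent, hence differ with probability at least `1 / 2`. If they differ at time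
`2n - 1`, then with probability at least `1 - α n` they differ at time `2n`, whatever the
coupling, because immersion keeps the conditional laws and these overlap little; and then they
differ at time `2n + 1`, because the first variable of a brick is a function of the second one. As
`α` is summable, the two copies still differ with probability at least `1 / 4` at a fixed time.
But a variable that is a function of `V` takes the same value on both copies with probability
tending to `1` as `m` tends to `-∞`.
-/

noncomputable section

namespace BackwardFiltration

section Completion

variable {Ω : Type*} {mΩ : MeasurableSpace Ω} {μ : Measure Ω}

theorem measurableSet_completed_iff {m : MeasurableSpace Ω} {s : Set Ω} :
    MeasurableSet[completed μ m] s ↔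
      (∃ t, MeasurableSet[m] t ∧ s =ᵐ[μ] t) ∧ MeasurableSet[mΩ] s :=
  MeasurableSpace.measurableSet_inf

theorem le_completed {m : MeasurableSpace Ω} (hm : m ≤ mΩ) : m ≤ completed μ m :=
  le_inf le_eventuallyMeasurableSpace hm

theorem measurableSet_completed_of_ae_eq {m : MeasurableSpace Ω} {s t : Set Ω}
    (ht : MeasurableSet[completed μ m] t) (hs : MeasurableSet[mΩ] s) (hst : s =ᵐ[μ] t) :
    MeasurableSet[completed μ m] s := by
  obtain ⟨⟨u, hu, htu⟩, -⟩ := measurableSet_completed_iff.1 ht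
  exact measurableSet_completed_iff.2 ⟨⟨u, hu, hst.trans htu⟩, hs⟩

theorem completed_le_completed {m₁ m₂ : MeasurableSpace Ω} (h : m₁ ≤ completed μ m₂) :
    completed μ m₁ ≤ completed μ m₂ := by
  intro s hs
  obtain ⟨⟨t, ht, hst⟩, hs⟩ := measurableSet_completed_iff.1 hs
  exact measurableSet_completed_of_ae_eq (h t ht) hs hst

theorem comap_le_completed_of_ae_eq {m : MeasurableSpace Ω} {E : Type*} [MeasurableSpace E]
    {X Y : Ω → E} (hX : Measurable[mΩ] X) (hY : Measurable[completed μ m] Y) (h : X =ᵐ[μ] Y) :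
    MeasurableSpace.comap X inferInstance ≤ completed μ m := by
  rintro s ⟨t, ht, rfl⟩
  exact measurableSet_completed_of_ae_eq (hY ht) (hX ht) (h.preimage t)

theorem indep_completed_left {m₁ m₂ : MeasurableSpace Ω} (h : Indep m₁ m₂ μ) :
    Indep (completed μ m₁) m₂ μ := by
  rw [Indep_iff] at h ⊢
  intro s t hs ht
  obtain ⟨⟨u, hu, hsu⟩, -⟩ := measurableSet_completed_iff.1 hs
  rw [measure_congr (hsu.inter (ae_eq_refl t)), measure_congr hsu, h u t hu ht]

theorem naturalFiltration_apply {ι : Type*} [Preorder ι] {E : ι → Type*}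
    [∀ n, MeasurableSpace (E n)] (Z : ∀ n, Ω → E n) (n : ι) :
    naturalFiltration μ Z n =
      completed μ (⨆ k : Set.Iic n, MeasurableSpace.comap (Z k) inferInstance) := rfl

theorem naturalFiltration_le {ι : Type*} [Preorder ι] {E : ι → Type*}
    [∀ n, MeasurableSpace (E n)] {Z : ∀ n, Ω → E n} {n : ι} {m : MeasurableSpace Ω}
    (h : ∀ k ≤ n, MeasurableSpace.comap (Z k) inferInstance ≤ completed μ m) :
    naturalFiltration μ Z n ≤ completed μ m :=
  completed_le_completed (iSup_le fun k => h k k.2)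

theorem comap_le_naturalFiltration {ι : Type*} [Preorder ι] {E : ι → Type*}
    [∀ n, MeasurableSpace (E n)] {Z : ∀ n, Ω → E n} {k n : ι} (hkn : k ≤ n)
    (hk : Measurable (Z k)) :
    MeasurableSpace.comap (Z k) inferInstance ≤ naturalFiltration μ Z n := by
  intro s hs
  refine measurableSet_completed_iff.2 ⟨⟨s, ?_, ae_eq_refl s⟩, hk.comap_le s hs⟩
  exact le_iSup_of_le (f := fun k : Set.Iic n => MeasurableSpace.comap (Z k) inferInstance)
    (⟨k, hkn⟩ : Set.Iic n) le_rfl s hs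

end Completion

section ProductType

variable {Ω : Type*} {mΩ : MeasurableSpace Ω} {μ : Measure Ω}

theorem iIndep_of_indep_iSup_lt [IsProbabilityMeasure μ] {ι : Type*} [LinearOrder ι]
    (m : ι → MeasurableSpace Ω) (h : ∀ i, Indep (m i) (⨆ j, ⨆ _ : j < i, m j) μ) :
    iIndep m μ := by
  rw [iIndep_iff]
  intro s
  induction s using Finset.induction_on_max with
  | empty => simp
  | insert a s has ih =>
    intro f hf
    have ha : a ∉ s := fun hmem => lt_irrefl _ (has a hmem)
    rw [Finset.prod_insert ha, Finset.set_biInter_insert,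
      ← ih fun i hi => hf i (Finset.mem_insert_of_mem hi)]
    refine (Indep_iff _ _ _).1 (h a) _ _ (hf a (Finset.mem_insert_self _ _)) ?_
    refine MeasurableSet.biInter s.countable_toSet fun i hi => ?_
    exact le_iSup₂_of_le (f := fun j (_ : j < a) => m j) i (has i hi) le_rfl _
      (hf i (Finset.mem_insert_of_mem hi))

theorem comap_measurableEmbedding_comp {E E' : Type*} [mE : MeasurableSpace E]
    [mE' : MeasurableSpace E'] {c : E → E'} (hc : MeasurableEmbedding c) (X : Ω → E) :
    MeasurableSpace.comap (fun ω => c (X ω)) mE' = MeasurableSpace.comap X mE := by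
  rw [← hc.comap_eq, MeasurableSpace.comap_comp]; rfl

/-- The block of the times `k` following all the `φ e`, `e < d`, up to `φ d`: the times whose
innovations are merged into a single one when a filtration is observed at the times `φ` only. -/
def block {κ : Type*} [Preorder κ] (φ : κ → ℤ) (d : κ) : Set ℤ :=
  {k | k ≤ φ d ∧ ∀ e < d, φ e < k}

section Block

variable {κ : Type*} [LinearOrder κ] {φ : κ → ℤ}

theorem exists_mem_block (hφ : StrictMono φ) {d : κ} {k : ℤ} (hk : k ≤ φ d) :
    ∃ e ≤ d, k ∈ block φ e := by
  obtain ⟨z, ⟨⟨e, rfl⟩, hz⟩, hmin⟩ := Int.exists_least_of_bdd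
    (P := fun z => z ∈ Set.range φ ∧ k ≤ z) ⟨k, fun z hz => hz.2⟩ ⟨φ d, ⟨d, rfl⟩, hk⟩
  refine ⟨e, hφ.le_iff_le.1 (hmin _ ⟨⟨d, rfl⟩, hk⟩), hz, fun e' he' => ?_⟩
  by_contra! hcon
  exact absurd (hmin _ ⟨⟨e', rfl⟩, hcon⟩) (not_le.2 (hφ he'))

/-- The real random variable merging the innovations `U k`, for `k` in the block of `d`. -/
def blockVariable (φ : κ → ℤ) (U : ℤ → Ω → ℝ) (d : κ) (ω : Ω) : ℝ :=
  embeddingReal (block φ d → ℝ) fun k => U k ω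

theorem measurable_blockVariable {U : ℤ → Ω → ℝ} (hU : ∀ k, Measurable (U k)) (d : κ) :
    Measurable (blockVariable φ U d) :=
  (measurableEmbedding_embeddingReal _).measurable.comp (measurable_pi_lambda _ fun k => hU k)

theorem comap_blockVariable (φ : κ → ℤ) (U : ℤ → Ω → ℝ) (d : κ) :
    MeasurableSpace.comap (blockVariable φ U d) inferInstance =
      ⨆ k ∈ block φ d, MeasurableSpace.comap (U k) inferInstance := by
  unfold blockVariable
  rw [comap_measurableEmbedding_comp (measurableEmbedding_embeddingReal (block φ d → ℝ))
    (fun ω (k : block φ d) => U k ω), MeasurableSpace.pi, MeasurableSpace.comap_iSup, iSup_subtype']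
  exact iSup_congr fun k => MeasurableSpace.comap_comp

theorem iIndepFun_blockVariable [IsProbabilityMeasure μ] {U : ℤ → Ω → ℝ}
    (hU : ∀ k, Measurable (U k)) (hind : iIndepFun U μ) :
    iIndepFun (blockVariable φ U) μ := by
  refine iIndep_of_indep_iSup_lt _ fun d => ?_
  have hdisj : Disjoint (block φ d) {k | ∃ e < d, k ≤ φ e} :=
    Set.disjoint_left.2 fun k hk ⟨e, he, hke⟩ => not_lt.2 hke (hk.2 e he)
  have hblocks := indep_iSup_of_disjoint (fun k => (hU k).comap_le) hind hdisj
  rw [← comap_blockVariable] at hblocks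
  refine indep_of_indep_of_le_right hblocks (iSup₂_le fun e he => ?_)
  rw [comap_blockVariable]
  exact biSup_mono fun k hk => ⟨e, he, hk.1⟩

theorem iSup_comap_blockVariable (hφ : StrictMono φ) (U : ℤ → Ω → ℝ) (d : κ) :
    ⨆ e : Set.Iic d, MeasurableSpace.comap (blockVariable φ U e) inferInstance =
      ⨆ k : Set.Iic (φ d), MeasurableSpace.comap (U k) inferInstance := by
  simp only [comap_blockVariable]
  refine le_antisymm (iSup_le fun e => iSup₂_le fun k hk => ?_) (iSup_le fun k => ?_)
  · exact le_iSup_of_le (⟨k, hk.1.trans (hφ.monotone e.2)⟩ : Set.Iic (φ d)) le_rfl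
  · obtain ⟨e, hed, hke⟩ := exists_mem_block hφ k.2
    exact le_iSup_of_le (⟨e, hed⟩ : Set.Iic d) (le_iSup₂_of_le k.1 hke le_rfl)

theorem isProductType_reindex [IsProbabilityMeasure μ] (hφ : StrictMono φ) (ℱ : Filtration ℤ mΩ)
    {U : ℤ → Ω → ℝ} (hU : ∀ k, Measurable (U k)) (hind : iIndepFun U μ)
    (hgen : ∀ d, ℱ (φ d) = naturalFiltration μ U (φ d)) :
    IsProductType μ (reindex ℱ φ hφ.monotone) := by
  refine ⟨blockVariable φ U, measurable_blockVariable hU, iIndepFun_blockVariable hU hind, ?_⟩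
  refine Filtration.ext (funext fun d => (hgen d).trans ?_)
  exact congrArg (completed μ) (iSup_comap_blockVariable hφ U d).symm

end Block

theorem immersed_refl [IsFiniteMeasure μ] {ι : Type*} [Preorder ι] (ℱ : Filtration ι mΩ) :
    Immersed μ ℱ ℱ := by
  refine ⟨fun _ => le_rfl, fun m n _ A B hA hB => ?_⟩
  have hA' : MeasurableSet A := ℱ.le n A hA
  have hB' : MeasurableSet B := ℱ.le m B hB
  have hBs : StronglyMeasurable[ℱ m] (B.indicator fun _ => (1 : ℝ)) :=
    stronglyMeasurable_const.indicator hB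
  have hmul : (A ∩ B).indicator (fun _ => (1 : ℝ)) =
      A.indicator (fun _ => (1 : ℝ)) * B.indicator (fun _ => (1 : ℝ)) :=
    Set.inter_indicator_one
  have hint : Integrable ((A ∩ B).indicator fun _ => (1 : ℝ)) μ :=
    (integrable_const _).indicator (hA'.inter hB')
  rw [condExp_of_stronglyMeasurable (ℱ.le m) hBs ((integrable_const _).indicator hB'), hmul]
  exact condExp_mul_of_stronglyMeasurable_right hBs (hmul ▸ hint)
    ((integrable_const _).indicator hA')

/-- The identity isomorphism of a filtered probability space. -/
def FilteredIso.refl {ι : Type*} [Preorder ι] (μ : Measure Ω) (ℱ : Filtration ι mΩ) :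
    FilteredIso μ ℱ μ ℱ where
  toEquiv := Equiv.refl _
  map_law _ := rfl
  map_borel _ _ _ _ h := h
  map_filtration _ _ := Iff.rfl

theorem IsProductType.isStandard [IsProbabilityMeasure μ] {ι : Type*} [Preorder ι]
    {ℱ : Filtration ι mΩ} (h : IsProductType μ ℱ) : IsStandard μ ℱ :=
  ⟨Ω, mΩ, μ, ℱ, ℱ, inferInstance, h, ⟨FilteredIso.refl μ ℱ⟩, immersed_refl ℱ⟩

end ProductType

section Transition

variable {Ω E E' : Type*} {m mΩ : MeasurableSpace Ω} {μ : Measure Ω} {X : Ω → E}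
  {Y : Ω → E'} {p : E → E' → ℝ}

theorem real_inter_preimage_eq_sum [IsFiniteMeasure μ] [MeasurableSpace E]
    [MeasurableSingletonClass E] (hX : Measurable[mΩ] X) (B : Set Ω) (T : Finset E) :
    μ.real (B ∩ X ⁻¹' T) = ∑ x ∈ T, μ.real (B ∩ X ⁻¹' {x}) := by
  have hsum := sum_measureReal_preimage_singleton (μ := μ.restrict B) T (f := X)
    fun x _ => hX (measurableSet_singleton x)
  rw [measureReal_restrict_apply (hX T.measurableSet), inter_comm] at hsum
  rw [← hsum]
  exact Finset.sum_congr rfl fun x _ => by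
    rw [measureReal_restrict_apply (hX (measurableSet_singleton x)), inter_comm]

theorem exists_inter_preimage_eq [MeasurableSpace E] {B : Set Ω}
    (hB : MeasurableSet[m ⊔ MeasurableSpace.comap X inferInstance] B) (x : E) :
    ∃ B', MeasurableSet[m] B' ∧ B ∩ X ⁻¹' {x} = B' ∩ X ⁻¹' {x} := by
  have hconst : (X ∘ Subtype.val : X ⁻¹' {x} → E) = fun _ => x := funext fun ω => ω.2
  have hB' : MeasurableSet[MeasurableSpace.comap Subtype.val
      (m ⊔ MeasurableSpace.comap X inferInstance)] ((↑) ⁻¹' B : Set (X ⁻¹' {x})) := ⟨B, hB, rfl⟩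
  rw [MeasurableSpace.comap_sup, MeasurableSpace.comap_comp, hconst, MeasurableSpace.comap_const,
    sup_bot_eq] at hB'
  obtain ⟨B', hB', heq⟩ := hB'
  refine ⟨B', hB', ?_⟩
  rw [inter_comm B, inter_comm B']
  exact (Subtype.preimage_val_eq_preimage_val_iff _ _ _).1 heq.symm

/-- The conditional law of the discrete random variable `Y` given the σ-field `m` is `p X`. This is
expressed by the joint probabilities with the events of `m`, so that no version of a conditional
probability has to be chosen; `X` is meant to be `m`-measurable, at least up to completion. -/
def HasTransition (μ : Measure Ω) (m : MeasurableSpace Ω) (X : Ω → E) (Y : Ω → E')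
    (p : E → E' → ℝ) : Prop :=
  ∀ B, MeasurableSet[m] B → ∀ x y,
    μ.real (B ∩ X ⁻¹' {x} ∩ Y ⁻¹' {y}) = μ.real (B ∩ X ⁻¹' {x}) * p x y

theorem HasTransition.mono {m' : MeasurableSpace Ω} (h : HasTransition μ m X Y p) (hm : m' ≤ m) :
    HasTransition μ m' X Y p :=
  fun B hB => h B (hm B hB)

theorem HasTransition.congr_right {q : E → E' → ℝ} (h : HasTransition μ m X Y p)
    (hpq : ∀ x y, μ.real (X ⁻¹' {x}) ≠ 0 → p x y = q x y) [IsFiniteMeasure μ] :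
    HasTransition μ m X Y q := by
  intro B hB x y
  rw [h B hB x y]
  by_cases hx : μ.real (X ⁻¹' {x}) = 0
  · rw [measureReal_mono_null inter_subset_right hx, zero_mul, zero_mul]
  · rw [hpq x y hx]

theorem HasTransition.real_inter_preimage [IsFiniteMeasure μ] [MeasurableSpace E']
    [MeasurableSingletonClass E'] (h : HasTransition μ m X Y p) (hY : Measurable[mΩ] Y)
    {B : Set Ω} (hB : MeasurableSet[m] B) (x : E) (S : Finset E') :
    μ.real (B ∩ X ⁻¹' {x} ∩ Y ⁻¹' S) = μ.real (B ∩ X ⁻¹' {x}) * ∑ y ∈ S, p x y := by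
  rw [real_inter_preimage_eq_sum hY, Finset.mul_sum]
  exact Finset.sum_congr rfl fun y _ => h B hB x y

theorem HasTransition.completed_sup_comap [MeasurableSpace E] (h : HasTransition μ m X Y p) :
    HasTransition μ (completed μ (m ⊔ MeasurableSpace.comap X inferInstance)) X Y p := by
  intro B hB x y
  obtain ⟨⟨t, ht, hBt⟩, -⟩ := measurableSet_completed_iff.1 hB
  obtain ⟨B', hB', htB'⟩ := exists_inter_preimage_eq ht x
  have hae : (B ∩ X ⁻¹' {x} : Set Ω) =ᵐ[μ] (B' ∩ X ⁻¹' {x} : Set Ω) :=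
    htB' ▸ hBt.inter (ae_eq_refl _)
  rw [measureReal_congr (hae.inter (ae_eq_refl (Y ⁻¹' {y}))), measureReal_congr hae]
  exact h B' hB' x y

/-- As `X` determines `X₀`, the event `X = x` is the event `X₀ = f x` together with a condition on
`Y` alone, by which the law of `Y` is then conditioned. -/
theorem HasTransition.of_indep_of_eq {E₀ : Type*} [MeasurableSpace E₀] [MeasurableSingletonClass E₀]
    [MeasurableSpace E'] [DiscreteMeasurableSpace E'] [IsFiniteMeasure μ] {X₀ : Ω → E₀}
    {g : E₀ → E' → E} {f : E → E₀} (hX₀ : Measurable[m] X₀)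
    (hY : Indep m (MeasurableSpace.comap Y inferInstance) μ)
    (hg : ∀ᵐ ω ∂μ, X ω = g (X₀ ω) (Y ω)) (hf : ∀ᵐ ω ∂μ, X₀ ω = f (X ω)) :
    HasTransition μ m X Y fun x y => (μ.real (Y ⁻¹' {y | g (f x) y = x}))⁻¹ *
      μ.real (Y ⁻¹' {y' | g (f x) y' = x ∧ y' = y}) := by
  intro B hB x y
  have hprod : ∀ T : Set E', μ.real (B ∩ X ⁻¹' {x} ∩ Y ⁻¹' T) =
      μ.real (B ∩ X₀ ⁻¹' {f x}) * μ.real (Y ⁻¹' {y | g (f x) y = x ∧ y ∈ T}) := by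
    intro T
    have hae : (B ∩ X ⁻¹' {x} ∩ Y ⁻¹' T : Set Ω) =ᵐ[μ]
        (B ∩ X₀ ⁻¹' {f x} ∩ Y ⁻¹' {y | g (f x) y = x ∧ y ∈ T} : Set Ω) := by
      filter_upwards [hg, hf] with ω hgω hfω
      refine propext ⟨fun ⟨⟨hBω, hx⟩, hT⟩ => ?_, fun ⟨⟨hBω, hx₀⟩, hx, hT⟩ => ?_⟩
      · have hx₀ : X₀ ω = f x := hfω.trans (congrArg f hx)
        exact ⟨⟨hBω, hx₀⟩, by rw [← hx₀, ← hgω]; exact hx, hT⟩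
      · have hx₀ : X₀ ω = f x := hx₀
        exact ⟨⟨hBω, by rw [← hx₀, ← hgω] at hx; exact hx⟩, hT⟩
    rw [measureReal_congr hae, measureReal_def, (Indep_iff _ _ _).1 hY _ _
      (hB.inter (hX₀ (measurableSet_singleton _))) ⟨_, .of_discrete, rfl⟩, ENNReal.toReal_mul]
    rfl
  have hx := hprod univ
  simp only [preimage_univ, inter_univ, mem_univ, and_true] at hx
  rw [hprod {y}, hx, mul_assoc]
  by_cases h0 : μ.real (Y ⁻¹' {y | g (f x) y = x}) = 0
  · have hle : {y' | g (f x) y' = x ∧ y' ∈ ({y} : Set E')} ⊆ {y | g (f x) y = x} :=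
      fun _ h => h.1
    rw [measureReal_mono_null (preimage_mono hle) h0, h0, zero_mul]
  · rw [mul_inv_cancel_left₀ h0]
    rfl

variable [MeasurableSpace E] [MeasurableSingletonClass E]

theorem condProb_eq (hX : Measurable[mΩ] X) (Y : Ω → E') (x : E) (y : E') :
    condProb μ Y X y x = (μ.real (X ⁻¹' {x}))⁻¹ * μ.real (X ⁻¹' {x} ∩ Y ⁻¹' {y}) := by
  rw [condProb, measureReal_def, cond_apply (hX (measurableSet_singleton x)), ENNReal.toReal_mul,
    ENNReal.toReal_inv]
  rfl

theorem HasTransition.eq_condProb (h : HasTransition μ m X Y p) (hX : Measurable[mΩ] X) {x : E}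
    (hx : μ.real (X ⁻¹' {x}) ≠ 0) (y : E') : p x y = condProb μ Y X y x := by
  have hjoint := h univ MeasurableSet.univ x y
  rw [univ_inter] at hjoint
  rw [condProb_eq hX, hjoint, inv_mul_cancel_left₀ hx]

theorem HasTransition.condProb [IsFiniteMeasure μ] (h : HasTransition μ m X Y p)
    (hX : Measurable[mΩ] X) :
    HasTransition μ m X Y fun x y => condProb μ Y X y x :=
  h.congr_right fun _ y hx => h.eq_condProb hX hx y

theorem HasTransition.of_indep {G : Type*} [MeasurableSpace G] [DiscreteMeasurableSpace G]
    {W : Ω → G} {g : E → G → E'} (hX : Measurable[m] X)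
    (hW : Indep m (MeasurableSpace.comap W inferInstance) μ) (hY : ∀ᵐ ω ∂μ, Y ω = g (X ω) (W ω)) :
    HasTransition μ m X Y fun x y => μ.real (W ⁻¹' {w | g x w = y}) := by
  intro B hB x y
  have hae : (B ∩ X ⁻¹' {x} ∩ Y ⁻¹' {y} : Set Ω) =ᵐ[μ]
      (B ∩ X ⁻¹' {x} ∩ W ⁻¹' {w | g x w = y} : Set Ω) := by
    filter_upwards [hY] with ω hω
    refine propext (and_congr_right fun hx => ?_)
    change Y ω = y ↔ g x (W ω) = y
    rw [hω, show X ω = x from hx.2]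
  rw [measureReal_congr hae, measureReal_def, (Indep_iff _ _ _).1 hW _ _
    (hB.inter (hX (measurableSet_singleton x))) ⟨_, .of_discrete, rfl⟩, ENNReal.toReal_mul]
  rfl

theorem condExp_indicator_ae_eq [Finite E] [IsFiniteMeasure μ] (hm : m ≤ mΩ)
    (hX : Measurable[m] X) {A : Set Ω} (hA : MeasurableSet[mΩ] A) {q : E → ℝ}
    (h : ∀ B, MeasurableSet[m] B → ∀ x,
      μ.real (B ∩ X ⁻¹' {x} ∩ A) = μ.real (B ∩ X ⁻¹' {x}) * q x) :
    μ[A.indicator (fun _ => (1 : ℝ)) | m] =ᵐ[μ] fun ω => q (X ω) := by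
  have := Fintype.ofFinite E
  have hX' : Measurable[mΩ] X := hX.mono hm le_rfl
  have hq : Measurable q := measurable_of_finite q
  have hqint : Integrable (fun ω => q (X ω)) μ :=
    (Integrable.of_finite (μ := μ.map X) (f := q)).comp_measurable hX'
  refine (ae_eq_condExp_of_forall_setIntegral_eq hm ((integrable_const _).indicator hA)
    (fun s _ _ => hqint.integrableOn) (fun B hB _ => ?_)
    (hq.comp hX).stronglyMeasurable.aestronglyMeasurable).symm
  have hsingle : ∀ (C : Set Ω) (x : E), ((μ.restrict C).map X).real {x} = μ.real (C ∩ X ⁻¹' {x}) :=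
    fun C x => by
      have hx := hX' (measurableSet_singleton x)
      rw [map_measureReal_apply hX' (measurableSet_singleton x), measureReal_restrict_apply hx,
        inter_comm]
  calc ∫ ω in B, q (X ω) ∂μ = ∑ x, μ.real (B ∩ X ⁻¹' {x}) * q x := by
        rw [← integral_map hX'.aemeasurable hq.aestronglyMeasurable (μ := μ.restrict B),
          integral_fintype .of_finite]
        simp only [hsingle, smul_eq_mul]
    _ = ∑ x, ((μ.restrict (B ∩ A)).map X).real {x} :=
        Finset.sum_congr rfl fun x _ => by rw [hsingle, ← h B hB x, inter_right_comm]
    _ = ∫ ω in B, A.indicator (fun _ => (1 : ℝ)) ω ∂μ := by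
        rw [sum_measureReal_singleton, map_measureReal_apply hX' (Finset.measurableSet _),
          setIntegral_indicator hA, setIntegral_const, smul_eq_mul, mul_one, Finset.coe_univ,
          preimage_univ, measureReal_restrict_apply_univ]

theorem HasTransition.condExp_ae_eq [Finite E] [IsFiniteMeasure μ] [MeasurableSpace E']
    [MeasurableSingletonClass E'] (h : HasTransition μ m X Y p) (hm : m ≤ mΩ)
    (hX : Measurable[m] X) (hY : Measurable[mΩ] Y) (S : Finset E') :
    μ[(Y ⁻¹' S).indicator (fun _ => (1 : ℝ)) | m] =ᵐ[μ] fun ω => ∑ y ∈ S, p (X ω) y :=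
  condExp_indicator_ae_eq (q := fun x => ∑ y ∈ S, p x y) hm hX (hY S.measurableSet)
    fun _ hB x => h.real_inter_preimage hY hB x S

end Transition

section Innovation

variable {Ω E E' : Type*} {m mΩ : MeasurableSpace Ω} {μ : Measure Ω} {X : Ω → E} {Y : Ω → E'}

theorem measurable_comp₂_of_finite {G : Type*} [Finite E] [Finite E'] [MeasurableSpace E]
    [MeasurableSingletonClass E] [MeasurableSpace E'] [MeasurableSingletonClass E']
    [MeasurableSpace G] (hX : Measurable[m] X) (hY : Measurable[m] Y) (f : E → E' → G) :
    Measurable[m] fun ω => f (X ω) (Y ω) :=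
  (measurable_of_finite (Function.uncurry f)).comp (hX.prodMk hY)

theorem indep_comap_of_forall_singleton [IsFiniteMeasure μ] [Finite E] [MeasurableSpace E]
    [MeasurableSingletonClass E] (hX : Measurable[mΩ] X)
    (h : ∀ B, MeasurableSet[m] B → ∀ x, μ.real (B ∩ X ⁻¹' {x}) = μ.real B * μ.real (X ⁻¹' {x})) :
    Indep m (MeasurableSpace.comap X inferInstance) μ := by
  rw [Indep_iff]
  rintro B _ hB ⟨T, -, rfl⟩
  have hsum := real_inter_preimage_eq_sum (μ := μ) hX univ T.toFinite.toFinset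
  simp only [univ_inter] at hsum
  rw [← T.toFinite.coe_toFinset, ← ENNReal.toReal_eq_toReal_iff' (by finiteness) (by finiteness),
    ENNReal.toReal_mul]
  simp only [← measureReal_def]
  rw [real_inter_preimage_eq_sum hX, hsum, Finset.mul_sum]
  exact Finset.sum_congr rfl fun x _ => h B hB x

theorem exists_enumeration {r : ℕ} (hr : 0 < r) {S : Finset E'} (hS : S.card = r) :
    ∃ (u : E' → Fin r) (v : Fin r → E'), (∀ i, v i ∈ S) ∧ ∀ y ∈ S, ∀ i, u y = i ↔ y = v i := by
  have : Nonempty (Fin r) := ⟨⟨0, hr⟩⟩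
  let e := S.equivFinOfCardEq hS
  let v : Fin r → E' := fun i => e.symm i
  have hv : Function.Injective v := Subtype.val_injective.comp e.symm.injective
  refine ⟨Function.invFun v, v, fun i => (e.symm i).2, fun y hy i => ?_⟩
  obtain ⟨j, rfl⟩ : ∃ j, v j = y := ⟨e ⟨y, hy⟩, by simp only [v, Equiv.symm_apply_apply]⟩
  rw [Function.leftInverse_invFun hv j, hv.eq_iff]

variable {S : E → Finset E'}

theorem HasTransition.ae_mem [Countable E] [Countable E'] [IsFiniteMeasure μ] {p : E → E' → ℝ}
    (h : HasTransition μ m X Y p) (hp : ∀ x, ∀ y ∉ S x, p x y = 0) :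
    ∀ᵐ ω ∂μ, Y ω ∈ S (X ω) := by
  have hnull : ∀ x y, ∀ᵐ ω ∂μ, y ∉ S x → ¬ (X ω = x ∧ Y ω = y) := by
    refine fun x y => eventually_imp_distrib_left.2 fun hy => ?_
    have hxy := h univ MeasurableSet.univ x y
    rw [hp x y hy, mul_zero, univ_inter, measureReal_eq_zero_iff] at hxy
    rw [ae_iff]
    simp only [not_not]
    exact hxy
  filter_upwards [ae_all_iff.2 fun x => ae_all_iff.2 (hnull x)] with ω hω
  by_contra hmem
  exact hω _ _ hmem ⟨rfl, rfl⟩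

/-- Numbering the possible values of `Y` for each value of `X` turns a uniform choice in the
random set `S X` into a uniform number independent of the past. -/
theorem HasTransition.exists_innovation [Finite E] [Finite E'] [MeasurableSpace E]
    [MeasurableSingletonClass E] [MeasurableSpace E'] [MeasurableSingletonClass E']
    [IsProbabilityMeasure μ] {r : ℕ} (hr : 0 < r) (hcard : ∀ x, (S x).card = r)
    (hX : Measurable[mΩ] X) (hY : Measurable[mΩ] Y)
    (h : HasTransition μ m X Y fun x => (S x : Set E').indicator fun _ => 1 / (r : ℝ)) :
    ∃ U : Ω → Fin r, (∀ i, μ.real (U ⁻¹' {i}) = 1 / (r : ℝ)) ∧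
      Indep m (MeasurableSpace.comap U inferInstance) μ ∧
      (∀ m' : MeasurableSpace Ω, Measurable[m'] X → Measurable[m'] Y → Measurable[m'] U) ∧
      MeasurableSpace.comap Y inferInstance ≤ completed μ
        (MeasurableSpace.comap X inferInstance ⊔ MeasurableSpace.comap U inferInstance) := by
  have := Fintype.ofFinite E
  choose u v hvS huv using fun x => exists_enumeration hr (hcard x)
  let U : Ω → Fin r := fun ω => u (X ω) (Y ω)
  have hUmeas : ∀ m' : MeasurableSpace Ω, Measurable[m'] X → Measurable[m'] Y → Measurable[m'] U :=
    fun _ hX hY => measurable_comp₂_of_finite hX hY u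
  have hU : Measurable[mΩ] U := hUmeas mΩ hX hY
  have hUY : ∀ᵐ ω ∂μ, ∀ i, U ω = i ↔ Y ω = v (X ω) i := by
    filter_upwards [h.ae_mem fun x y hy => indicator_of_notMem (mt Finset.mem_coe.1 hy) _]
      with ω hω i using huv _ _ hω i
  have hreal : ∀ B, MeasurableSet[m] B → ∀ i, μ.real (B ∩ U ⁻¹' {i}) = μ.real B * (1 / r) := by
    intro B hB i
    have hB_sum := real_inter_preimage_eq_sum (μ := μ) hX B Finset.univ
    have hBU_sum := real_inter_preimage_eq_sum (μ := μ) hX (B ∩ U ⁻¹' {i}) Finset.univ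
    simp only [Finset.coe_univ, preimage_univ, inter_univ] at hB_sum hBU_sum
    rw [hBU_sum, hB_sum, Finset.sum_mul]
    refine Finset.sum_congr rfl fun x _ => ?_
    have hae : (B ∩ U ⁻¹' {i} ∩ X ⁻¹' {x} : Set Ω) =ᵐ[μ]
        (B ∩ X ⁻¹' {x} ∩ Y ⁻¹' {v x i} : Set Ω) := by
      rw [inter_right_comm]
      filter_upwards [hUY] with ω hω
      refine propext (and_congr_right fun hx => ?_)
      exact (hω i).trans (by rw [show X ω = x from hx.2]; rfl)
    rw [measureReal_congr hae, h B hB]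
    exact congrArg _ (indicator_of_mem (Finset.mem_coe.2 (hvS x i)) _)
  have hunif : ∀ i, μ.real (U ⁻¹' {i}) = 1 / (r : ℝ) := fun i => by
    simpa only [univ_inter, probReal_univ, one_mul] using hreal univ MeasurableSet.univ i
  refine ⟨U, hunif, indep_comap_of_forall_singleton hU fun B hB i => ?_, hUmeas, ?_⟩
  · rw [hunif i, hreal B hB i]
  · have hle := le_completed (μ := μ) (sup_le hX.comap_le hU.comap_le)
    refine comap_le_completed_of_ae_eq hY (measurable_comp₂_of_finite
      ((comap_measurable X).mono (le_sup_left.trans hle) le_rfl)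
      ((comap_measurable U).mono (le_sup_right.trans hle) le_rfl) v) ?_
    filter_upwards [hUY] with ω hω using (hω _).1 rfl

end Innovation

/-- A process whose even-time values are independent and whose successive triples
`(Z (2n-2), Z (2n-1), Z (2n))` are strong bricks. -/
structure IsBrickChain {Ω : Type*} {mΩ : MeasurableSpace Ω} (μ : Measure Ω) {F : ℤ → Type*}
    [∀ n, Fintype (F n)] [∀ n, MeasurableSpace (F n)] (Z : ∀ n, Ω → F n) (r : ℤ → ℕ)
    (α : ℤ → ℝ) : Prop where
  meas : ∀ n ≤ 0, Measurable (Z n)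
  indep : iIndepFun (fun n : Set.Iic (0 : ℤ) => Z (2 * (n : ℤ))) μ
  brick : ∀ n ≤ 0, IsStrongBrick μ (Z (2 * n - 2)) (Z (2 * n - 1)) (Z (2 * n))
      (r (2 * n - 1)) (r (2 * n)) (α n)

section Chain

variable {Ω : Type*} {mΩ : MeasurableSpace Ω} {μ : Measure Ω}

theorem CondUniform.exists_indicator {E E' : Type*} {X : Ω → E} {Y : Ω → E'} {r : ℕ}
    (h : CondUniform μ Y X r) : ∃ S : E → Finset E', (∀ x, (S x).card = r) ∧
      ∀ x y, condProb μ Y X y x = (S x : Set E').indicator (fun _ => 1 / (r : ℝ)) y := by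
  obtain ⟨S, hS⟩ := h
  refine ⟨S, fun x => (hS x).1, fun x y => ?_⟩
  by_cases hy : y ∈ S x
  · rw [(hS x).2.1 y hy, indicator_of_mem (Finset.mem_coe.2 hy)]
  · rw [(hS x).2.2 y hy, indicator_of_notMem (mt Finset.mem_coe.1 hy)]

variable {F : ℤ → Type*} [∀ n, Fintype (F n)] [∀ n, MeasurableSpace (F n)] {Z : ∀ n, Ω → F n}
  {r : ℤ → ℕ} {α : ℤ → ℝ}

theorem IsBrickChain.comap_le (h : IsBrickChain μ Z r α) {j n : ℤ} (hjn : j ≤ n) (hj : j ≤ 0) :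
    MeasurableSpace.comap (Z j) inferInstance ≤ naturalFiltration μ Z n :=
  comap_le_naturalFiltration hjn (h.meas j hj)

theorem IsBrickChain.measurable_naturalFiltration (h : IsBrickChain μ Z r α) {j n : ℤ}
    (hjn : j ≤ n) (hj : j ≤ 0) : Measurable[naturalFiltration μ Z n] (Z j) :=
  (comap_measurable _).mono (h.comap_le hjn hj) le_rfl

theorem IsBrickChain.naturalFiltration_le_sup (h : IsBrickChain μ Z r α) {m n : ℤ}
    (hmn : m + 1 = n) (hn : n ≤ 0) : naturalFiltration μ Z n ≤ completed μ
      (naturalFiltration μ Z m ⊔ MeasurableSpace.comap (Z n) inferInstance) := by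
  have hle := le_completed (μ := μ) (sup_le ((naturalFiltration μ Z).le m) (h.meas n hn).comap_le)
  refine naturalFiltration_le fun k hk => ?_
  rcases hk.lt_or_eq with hlt | rfl
  · exact (h.comap_le (by omega) (by omega)).trans (le_sup_left.trans hle)
  · exact le_sup_right.trans hle

variable [∀ n, MeasurableSingletonClass (F n)]

theorem IsBrickChain.naturalFiltration_even_le (h : IsBrickChain μ Z r α) {n : ℤ} (hn : n ≤ 0) :
    naturalFiltration μ Z (2 * n) ≤ completed μ (⨆ i ∈ {i : Set.Iic (0 : ℤ) | (i : ℤ) ≤ n},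
      MeasurableSpace.comap (Z (2 * (i : ℤ))) inferInstance) := by
  set m := ⨆ i ∈ {i : Set.Iic (0 : ℤ) | (i : ℤ) ≤ n},
    MeasurableSpace.comap (Z (2 * (i : ℤ))) inferInstance
  have hm : m ≤ mΩ := iSup₂_le fun i _ =>
    (h.meas _ (by have : (i : ℤ) ≤ 0 := i.2; omega)).comap_le
  have heven : ∀ k ≤ n, Measurable[completed μ m] (Z (2 * k)) := fun k hk =>
    (comap_measurable _).mono ((le_iSup₂_of_le (⟨k, hk.trans hn⟩ : Set.Iic (0 : ℤ)) hk le_rfl).trans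
      (le_completed hm)) le_rfl
  refine naturalFiltration_le fun j hj => ?_
  obtain ⟨k, rfl | rfl⟩ : ∃ k, j = 2 * k ∨ j = 2 * k - 1 := ⟨(j + 1) / 2, by omega⟩
  · exact (heven k (by omega)).comap_le
  · obtain ⟨g, hg⟩ := (h.brick k (by omega)).eq_fun₁
    have hprev := heven (k - 1) (by omega)
    rw [show 2 * (k - 1) = 2 * k - 2 by ring] at hprev
    exact comap_le_completed_of_ae_eq (h.meas _ (by omega))
      (measurable_comp₂_of_finite hprev (heven k (by omega)) g) hg

theorem IsBrickChain.indep_even (h : IsBrickChain μ Z r α) {n k : ℤ} (hk : k ≤ 0) (hnk : n < k) :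
    Indep (naturalFiltration μ Z (2 * n)) (MeasurableSpace.comap (Z (2 * k)) inferInstance) μ := by
  refine indep_of_indep_of_le_left (indep_completed_left ?_) (h.naturalFiltration_even_le
    (hnk.le.trans hk))
  have hmem : (⟨k, hk⟩ : Set.Iic (0 : ℤ)) ∈ {i : Set.Iic (0 : ℤ) | n < i} := hnk
  refine indep_of_indep_of_le_right (indep_iSup_of_disjoint (fun i => ?_) h.indep
    (Set.disjoint_left.2 fun i (hi : (i : ℤ) ≤ n) (hi' : n < i) => hi.not_gt hi'))
    (le_iSup₂_of_le _ hmem le_rfl)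
  exact (h.meas _ (by have : (i : ℤ) ≤ 0 := i.2; omega)).comap_le

theorem IsBrickChain.indep_last (h : IsBrickChain μ Z r α) {n : ℤ} (hn : n ≤ 0) :
    Indep (naturalFiltration μ Z (2 * n - 2))
      (MeasurableSpace.comap (Z (2 * n)) inferInstance) μ := by
  have hind := h.indep_even (n := n - 1) hn (by omega)
  rwa [show 2 * (n - 1) = 2 * n - 2 by ring] at hind

variable [IsProbabilityMeasure μ]

theorem IsBrickChain.hasTransition_odd (h : IsBrickChain μ Z r α) {n : ℤ} (hn : n ≤ 0) :
    HasTransition μ (naturalFiltration μ Z (2 * n - 2)) (Z (2 * n - 2)) (Z (2 * n - 1))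
      fun x y => condProb μ (Z (2 * n - 1)) (Z (2 * n - 2)) y x := by
  obtain ⟨g, hg⟩ := (h.brick n hn).eq_fun₁
  exact (HasTransition.of_indep (h.measurable_naturalFiltration le_rfl (by omega))
    (h.indep_last hn) hg).condProb (h.meas _ (by omega))

theorem IsBrickChain.hasTransition_even (h : IsBrickChain μ Z r α) {n : ℤ} (hn : n ≤ 0) :
    HasTransition μ (naturalFiltration μ Z (2 * n - 1)) (Z (2 * n - 1)) (Z (2 * n))
      fun x y => condProb μ (Z (2 * n)) (Z (2 * n - 1)) y x := by
  obtain ⟨g, hg⟩ := (h.brick n hn).eq_fun₁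
  obtain ⟨f, hf⟩ := (h.brick n hn).eq_fun₀
  exact (((HasTransition.of_indep_of_eq (h.measurable_naturalFiltration le_rfl (by omega))
    (h.indep_last hn) hg hf).completed_sup_comap).mono
      (h.naturalFiltration_le_sup (by ring) (by omega))).condProb (h.meas _ (by omega))

theorem IsBrickChain.exists_transition (h : IsBrickChain μ Z r α) {m n : ℤ} (hmn : m + 1 = n)
    (hn : n ≤ 0) : 0 < r n ∧ ∃ S : F m → Finset (F n), (∀ x, (S x).card = r n) ∧
      HasTransition μ (naturalFiltration μ Z m) (Z m) (Z n)
        fun x => (S x : Set (F n)).indicator fun _ => 1 / (r n : ℝ) := by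
  obtain ⟨k, rfl | rfl⟩ : ∃ k, n = 2 * k ∨ n = 2 * k - 1 := ⟨(n + 1) / 2, by omega⟩
  · obtain rfl : m = 2 * k - 1 := by omega
    have hbrick := h.brick k (by omega)
    obtain ⟨S, hcard, hS⟩ := hbrick.cond₂.exists_indicator
    exact ⟨hbrick.pos₂, S, hcard,
      (h.hasTransition_even (by omega)).congr_right fun x y _ => hS x y⟩
  · obtain rfl : m = 2 * k - 2 := by omega
    have hbrick := h.brick k (by omega)
    obtain ⟨S, hcard, hS⟩ := hbrick.cond₁.exists_indicator
    exact ⟨hbrick.pos₁, S, hcard,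
      (h.hasTransition_odd (by omega)).congr_right fun x y _ => hS x y⟩

theorem IsBrickChain.isMarkov (h : IsBrickChain μ Z r α) : IsMarkov μ Z := by
  intro n hn A _
  obtain ⟨-, S, -, hS⟩ := h.exists_transition (sub_add_cancel n 1) hn
  have hpred : n - 1 ≤ 0 := by omega
  rw [← A.toFinite.coe_toFinset]
  exact (hS.condExp_ae_eq ((naturalFiltration μ Z).le _)
    (h.measurable_naturalFiltration le_rfl hpred) (h.meas n hn) _).trans
    ((hS.mono (h.comap_le le_rfl hpred)).condExp_ae_eq (h.meas _ hpred).comap_le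
      (comap_measurable _) (h.meas n hn) _).symm

theorem IsBrickChain.exists_innovation (h : IsBrickChain μ Z r α) {m n : ℤ} (hmn : m + 1 = n)
    (hn : n ≤ 0) : ∃ U : Ω → Fin (r n), (∀ i, μ.real (U ⁻¹' {i}) = 1 / (r n : ℝ)) ∧
      Indep (naturalFiltration μ Z m) (MeasurableSpace.comap U inferInstance) μ ∧
      MeasurableSpace.comap U inferInstance ≤ naturalFiltration μ Z n ∧
      MeasurableSpace.comap (Z n) inferInstance ≤ completed μ
        (MeasurableSpace.comap (Z m) inferInstance ⊔ MeasurableSpace.comap U inferInstance) := by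
  obtain ⟨hr, S, hcard, hS⟩ := h.exists_transition hmn hn
  have hm : m ≤ 0 := by omega
  obtain ⟨U, hunif, hind, hU, hgen⟩ :=
    hS.exists_innovation hr hcard (h.meas m hm) (h.meas n hn)
  exact ⟨U, hunif, hind, (hU _ (h.measurable_naturalFiltration (by omega) hm)
    (h.measurable_naturalFiltration le_rfl hn)).comap_le, hgen⟩

theorem IsBrickChain.isAdicFiltration (h : IsBrickChain μ Z r α) :
    IsAdicFiltration μ (naturalFiltration μ Z) r := by
  intro n hn
  obtain ⟨U, hunif, hind, hU, hgen⟩ := h.exists_innovation (sub_add_cancel n 1) hn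
  have hU' := hU.trans ((naturalFiltration μ Z).le n)
  refine ⟨U, measurable_iff_comap_le.2 hU', hunif, hind, le_antisymm ?_ ?_⟩
  · have hle := le_completed (μ := μ) (sup_le ((naturalFiltration μ Z).le (n - 1)) hU')
    refine (h.naturalFiltration_le_sup (sub_add_cancel n 1) hn).trans (completed_le_completed
      (sup_le (le_sup_left.trans hle) (hgen.trans (completed_mono μ ?_))))
    exact sup_le_sup_right (h.comap_le le_rfl (by omega)) _
  · exact completed_le_completed (sup_le ((naturalFiltration μ Z).mono (by omega)) hU)

end Chain

section Standard

variable {Ω : Type*} {mΩ : MeasurableSpace Ω} {μ : Measure Ω}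

theorem exists_real_comap_eq {E : Type*} [MeasurableSpace E] [StandardBorelSpace E] {X : Ω → E}
    (hX : Measurable X) : ∃ U : Ω → ℝ, Measurable U ∧
      MeasurableSpace.comap U inferInstance = MeasurableSpace.comap X inferInstance :=
  ⟨fun ω => embeddingReal E (X ω), (measurableEmbedding_embeddingReal E).measurable.comp hX,
    comap_measurableEmbedding_comp (measurableEmbedding_embeddingReal E) X⟩

/-- `U` is the innovation at time `k` of a process `Z` on `ℤ` which is stopped at time `0` and
observed neither at positive times nor at the times `2n-1`, `n ∈ M`: it is trivial at those times,
it is `Z (2n)` itself at the time `2n` following a skipped time, and it is otherwise independent of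
the past and completes `Z (k-1)` to determine `Z k`. -/
structure IsInnovationAt (μ : Measure Ω) {F : ℤ → Type*} [∀ n, MeasurableSpace (F n)]
    (Z : ∀ n, Ω → F n) (M : Set ℤ) (k : ℤ) (U : Ω → ℝ) : Prop where
  meas : Measurable U
  adapted : MeasurableSpace.comap U inferInstance ≤ naturalFiltration μ Z k
  eq_bot : (0 < k ∨ ∃ n ∈ M, k = 2 * n - 1) → MeasurableSpace.comap U inferInstance = ⊥
  restart : (∃ n ∈ M, k = 2 * n) →
    MeasurableSpace.comap U inferInstance = MeasurableSpace.comap (Z k) inferInstance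
  indep : k ≤ 0 → (∀ n ∈ M, k ≠ 2 * n - 1 ∧ k ≠ 2 * n) →
    Indep (MeasurableSpace.comap U inferInstance) (naturalFiltration μ Z (k - 1)) μ
  generate : k ≤ 0 → (∀ n ∈ M, k ≠ 2 * n - 1 ∧ k ≠ 2 * n) →
    MeasurableSpace.comap (Z k) inferInstance ≤ completed μ
      (MeasurableSpace.comap (Z (k - 1)) inferInstance ⊔ MeasurableSpace.comap U inferInstance)

variable {F : ℤ → Type*} [∀ n, MeasurableSpace (F n)] {Z : ∀ n, Ω → F n} {r : ℤ → ℕ} {α : ℤ → ℝ}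
  {M : Set ℤ}

section Innovations

variable {U : ℤ → Ω → ℝ} (hU : ∀ k, IsInnovationAt μ Z M k (U k))

include hU

theorem iSup_comap_innovation_le {k n : ℤ} (hkn : ∀ j < k, j ≤ n ∨ ∃ i ∈ M, j = 2 * i - 1) :
    (⨆ j, ⨆ _ : j < k, MeasurableSpace.comap (U j) inferInstance) ≤ naturalFiltration μ Z n := by
  refine iSup₂_le fun j hj => ?_
  rcases hkn j hj with hj | hj
  · exact (hU j).adapted.trans ((naturalFiltration μ Z).mono hj)
  · exact (hU j).eq_bot (Or.inr hj) ▸ bot_le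

theorem comap_le_naturalFiltration_innovation {n : ℤ} (hn : n ∈ M) {e : ℤ} (hne : 2 * n ≤ e)
    (he : e ≤ 0) (heM : ∀ i ∈ M, e ≠ 2 * i - 1) :
    MeasurableSpace.comap (Z e) inferInstance ≤ naturalFiltration μ U e := by
  have hUe : ∀ e, MeasurableSpace.comap (U e) inferInstance ≤ naturalFiltration μ U e :=
    fun e => comap_le_naturalFiltration le_rfl (hU e).meas
  induction e, hne using Int.leInduction with
  | base => exact (hU _).restart ⟨n, hn, rfl⟩ ▸ hUe _
  | succ e _ ih =>
    by_cases hrestart : ∃ i ∈ M, e + 1 = 2 * i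
    · exact (hU _).restart hrestart ▸ hUe _
    · push Not at hrestart
      have hprev := ih (by omega) fun i hi hei => hrestart i hi (by omega)
      have hgen := (hU (e + 1)).generate he fun i hi => ⟨heM i hi, hrestart i hi⟩
      rw [add_sub_cancel_right] at hgen
      exact hgen.trans (completed_le_completed (sup_le
        (hprev.trans ((naturalFiltration μ U).mono (by omega))) (hUe _)))

variable [∀ n, Fintype (F n)] [∀ n, MeasurableSingletonClass (F n)]

theorem IsBrickChain.iIndepFun_innovation [IsProbabilityMeasure μ] (h : IsBrickChain μ Z r α)
    (hM : ∀ n ∈ M, n ≤ 0) : iIndepFun U μ := by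
  refine iIndep_of_indep_iSup_lt _ fun k => ?_
  by_cases htrivial : 0 < k ∨ ∃ n ∈ M, k = 2 * n - 1
  · rw [(hU k).eq_bot htrivial]
    exact indep_bot_left _
  by_cases hrestart : ∃ n ∈ M, k = 2 * n
  · rw [(hU k).restart hrestart]
    obtain ⟨n, hn, rfl⟩ := hrestart
    refine indep_of_indep_of_le_right (h.indep_even (hM n hn) (sub_one_lt n)).symm
      (iSup_comap_innovation_le hU fun j hj => ?_)
    by_cases hskip : j = 2 * n - 1
    · exact Or.inr ⟨n, hn, hskip⟩
    · exact Or.inl (by omega)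
  · push Not at htrivial hrestart
    exact indep_of_indep_of_le_right
      ((hU k).indep htrivial.1 fun n hn => ⟨htrivial.2 n hn, hrestart n hn⟩)
      (iSup_comap_innovation_le hU fun j hj => Or.inl (by omega))

theorem IsBrickChain.naturalFiltration_eq_innovation (h : IsBrickChain μ Z r α)
    (hM : ∀ n ∈ M, n ≤ 0) (hinf : M.Infinite) {d : ℤ} (hd : d ≤ 0) (hdM : ∀ n ∈ M, d ≠ 2 * n - 1) :
    naturalFiltration μ Z d = naturalFiltration μ U d := by
  have hfar : ∀ e : ℤ, ∃ n ∈ M, 2 * n ≤ e := by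
    intro e
    by_contra! hcon
    refine hinf ((Set.finite_Icc (e / 2) 0).subset fun n hn => ⟨?_, hM n hn⟩)
    have := hcon n hn
    omega
  have hZ : ∀ e ≤ d, (∀ i ∈ M, e ≠ 2 * i - 1) →
      MeasurableSpace.comap (Z e) inferInstance ≤ naturalFiltration μ U d := by
    intro e he heM
    obtain ⟨n, hn, hne⟩ := hfar e
    exact (comap_le_naturalFiltration_innovation hU hn hne (he.trans hd) heM).trans
      ((naturalFiltration μ U).mono he)
  refine le_antisymm (naturalFiltration_le fun e he => ?_) (naturalFiltration_le fun k hk =>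
    (hU k).adapted.trans ((naturalFiltration μ Z).mono hk))
  by_cases heM : ∃ i ∈ M, e = 2 * i - 1
  · obtain ⟨i, hi, rfl⟩ := heM
    have hi0 := hM i hi
    have hid := hdM i hi
    obtain ⟨g, hg⟩ := (h.brick i hi0).eq_fun₁
    refine comap_le_completed_of_ae_eq (h.meas _ (by omega)) (measurable_comp₂_of_finite
      ((comap_measurable _).mono (hZ (2 * i - 2) ?_ ?_) le_rfl)
      ((comap_measurable _).mono (hZ (2 * i) ?_ ?_) le_rfl) g) hg
    all_goals omega
  · exact hZ e he (by push Not at heM; exact heM)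

end Innovations

variable [∀ n, Fintype (F n)] [∀ n, MeasurableSingletonClass (F n)]

theorem IsBrickChain.exists_isInnovationAt [IsProbabilityMeasure μ] (h : IsBrickChain μ Z r α)
    (hM : ∀ n ∈ M, n ≤ 0) (k : ℤ) : ∃ U, IsInnovationAt μ Z M k U := by
  by_cases htrivial : 0 < k ∨ ∃ n ∈ M, k = 2 * n - 1
  · have hbot : MeasurableSpace.comap (fun _ : Ω => (0 : ℝ)) inferInstance = ⊥ :=
      MeasurableSpace.comap_const 0
    refine ⟨fun _ => 0, measurable_const, hbot ▸ bot_le, fun _ => hbot, ?_, fun hk hkM => ?_,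
      fun hk hkM => ?_⟩
    · rintro ⟨n, hn, rfl⟩
      have := hM n hn
      rcases htrivial with _ | ⟨_, -, _⟩ <;> omega
    all_goals
      rcases htrivial with _ | ⟨n, hn, hkn⟩
      · omega
      · exact absurd hkn (hkM n hn).1
  have hk : k ≤ 0 := not_lt.1 fun hk => htrivial (Or.inl hk)
  by_cases hrestart : ∃ n ∈ M, k = 2 * n
  · obtain ⟨U, hU, hcomap⟩ := exists_real_comap_eq (h.meas k hk)
    obtain ⟨n, hn, hkn⟩ := hrestart
    exact ⟨U, hU, hcomap ▸ h.comap_le le_rfl hk, fun h => absurd h htrivial, fun _ => hcomap,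
      fun _ hkM => absurd hkn (hkM n hn).2, fun _ hkM => absurd hkn (hkM n hn).2⟩
  · obtain ⟨V, -, hind, hV, hgen⟩ := h.exists_innovation (sub_add_cancel k 1) hk
    obtain ⟨U, hU, hcomap⟩ := exists_real_comap_eq
      (measurable_iff_comap_le.2 (hV.trans ((naturalFiltration μ Z).le k)))
    exact ⟨U, hU, hcomap ▸ hV, fun h => absurd h htrivial, fun h => absurd h hrestart,
      fun _ _ => hcomap ▸ hind.symm, fun _ _ => hcomap ▸ hgen⟩

theorem IsBrickChain.isStandard_reindex [IsProbabilityMeasure μ] (h : IsBrickChain μ Z r α)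
    {κ : Type*} [LinearOrder κ] {φ : κ → ℤ} (hφ : StrictMono φ) (hφ0 : ∀ d, φ d ≤ 0)
    (hinf : {n : ℤ | n ≤ 0 ∧ 2 * n - 1 ∉ Set.range φ}.Infinite) :
    IsStandard μ (reindex (naturalFiltration μ Z) φ hφ.monotone) := by
  have hM : ∀ n ∈ {n : ℤ | n ≤ 0 ∧ 2 * n - 1 ∉ Set.range φ}, n ≤ 0 := fun n hn => hn.1
  choose U hU using h.exists_isInnovationAt hM
  exact (isProductType_reindex hφ _ (fun k => (hU k).meas) (h.iIndepFun_innovation hU hM)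
    fun d => h.naturalFiltration_eq_innovation hU hM hinf (hφ0 d)
      fun n hn hd => hn.2 ⟨d, hd⟩).isStandard

end Standard

section L0

variable {Ω : Type*} {m mΩ : MeasurableSpace Ω} {μ : Measure Ω}

theorem exists_mem_L0 (hm : m ≤ mΩ) {X : Ω → ℝ} (hX : AEStronglyMeasurable[m] X μ) :
    ∃ Y : L0 μ m, (Y : Ω →ₘ[μ] ℝ) =ᵐ[μ] X :=
  have hY := AEEqFun.coeFn_mk X (hX.mono hm)
  ⟨⟨AEEqFun.mk X (hX.mono hm), hX.congr hY.symm⟩, hY⟩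

theorem exists_mem_L0_comp (hm : m ≤ mΩ) (X : ℕ → L0 μ m) {g : (ℕ → ℝ) → ℝ} (hg : Measurable g) :
    ∃ Y : L0 μ m, (Y : Ω →ₘ[μ] ℝ) =ᵐ[μ] fun ω => g fun k => (X k : Ω →ₘ[μ] ℝ) ω := by
  choose x hx hXx using fun k => (X k).2
  have hgx : Measurable[m] fun ω => g fun k => x k ω :=
    hg.comp (@measurable_pi_lambda _ _ _ m _ _ fun k => (hx k).measurable)
  refine exists_mem_L0 hm ⟨_, hgx.stronglyMeasurable, ?_⟩
  filter_upwards [ae_all_iff.2 hXx] with ω hω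
  simp only [hω]

end L0

section Isomorphism

variable {Ω Ω' ι : Type*} [Preorder ι] {mΩ : MeasurableSpace Ω} {mΩ' : MeasurableSpace Ω'}
  {μ : Measure Ω} {μ' : Measure Ω'} {ℱ : Filtration ι mΩ} {ℱ' : Filtration ι mΩ'}
  {E E' E'' : Type*} [MeasurableSpace E] [StandardBorelSpace E] [MeasurableSpace E']
  [StandardBorelSpace E'] [MeasurableSpace E''] [StandardBorelSpace E'']

/-- The inverse of an isomorphism of filtered probability spaces. -/
def FilteredIso.symm (Φ : FilteredIso μ ℱ μ' ℱ') : FilteredIso μ' ℱ' μ ℱ where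
  toEquiv := Φ.toEquiv.symm
  map_law X := by simpa using (Φ.map_law (Φ.toEquiv.symm X)).symm
  map_borel X Y g hg hY := by
    obtain ⟨W, hW⟩ := exists_mem_L0_comp (iSup_le ℱ.le) (fun k => Φ.toEquiv.symm (X k)) hg
    have hΦW := Φ.map_borel (fun k => Φ.toEquiv.symm (X k)) W g hg hW
    simp only [Equiv.apply_symm_apply] at hΦW
    have hYW : Φ.toEquiv W = Y := Subtype.ext (AEEqFun.ext (hΦW.trans hY.symm))
    rwa [← hYW, Equiv.symm_apply_apply]
  map_filtration n X := by simpa using (Φ.map_filtration n (Φ.toEquiv.symm X)).symm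

/-- The isomorphism `Φ` sends the random variable `X` to `X'`. An isomorphism acts on classes of
real random variables only, so `X` and `X'` are read in `ℝ` through a Borel embedding. -/
def FilteredIso.Corresponds (Φ : FilteredIso μ ℱ μ' ℱ') (X : Ω → E) (X' : Ω' → E) : Prop :=
  ∃ Y : L0 μ (⨆ n, ℱ n), (Y : Ω →ₘ[μ] ℝ) =ᵐ[μ] (fun ω => embeddingReal E (X ω)) ∧
    (Φ.toEquiv Y : Ω' →ₘ[μ'] ℝ) =ᵐ[μ'] fun ω => embeddingReal E (X' ω)

namespace FilteredIso.Corresponds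

variable {Φ : FilteredIso μ ℱ μ' ℱ'} {X : Ω → E} {X' : Ω' → E} {Y : Ω → E'} {Y' : Ω' → E'}

theorem symm (h : Φ.Corresponds X X') : Φ.symm.Corresponds X' X := by
  obtain ⟨V, hV, hV'⟩ := h
  exact ⟨Φ.toEquiv V, hV', by rwa [FilteredIso.symm, Equiv.symm_apply_apply]⟩

theorem measure_preimage_eq (h : Φ.Corresponds X X') {S : Set E} (hS : MeasurableSet S) :
    μ' (X' ⁻¹' S) = μ (X ⁻¹' S) := by
  obtain ⟨V, hV, hV'⟩ := h
  have hc := measurableEmbedding_embeddingReal E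
  have hlaw := congrArg (fun ρ => ρ (embeddingReal E '' S)) (Φ.map_law V)
  rw [Measure.map_apply (AEEqFun.measurable _) (hc.measurableSet_image.2 hS),
    Measure.map_apply (AEEqFun.measurable _) (hc.measurableSet_image.2 hS),
    measure_congr (hV'.preimage _), measure_congr (hV.preimage _)] at hlaw
  have himage := hc.injective.preimage_image S
  exact (congrArg (fun T => μ' (X' ⁻¹' T)) himage).symm.trans
    (hlaw.trans (congrArg (fun T => μ (X ⁻¹' T)) himage))

theorem comp₂ (hX : Φ.Corresponds X X') (hY : Φ.Corresponds Y Y') {g : E × E' → E''}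
    (hg : Measurable g) :
    Φ.Corresponds (fun ω => g (X ω, Y ω)) fun ω => g (X' ω, Y' ω) := by
  obtain ⟨V, hV, hV'⟩ := hX
  obtain ⟨W, hW, hW'⟩ := hY
  obtain ⟨G, hG, hGg⟩ := ((measurableEmbedding_embeddingReal E).prodMap
    (measurableEmbedding_embeddingReal E')).exists_measurable_extend
    ((measurableEmbedding_embeddingReal E'').measurable.comp hg) fun _ => inferInstance
  have hG' : Measurable fun s : ℕ → ℝ => G (s 0, s 1) :=
    hG.comp ((measurable_pi_apply 0).prodMk (measurable_pi_apply 1))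
  let T : ℕ → L0 μ (⨆ n, ℱ n) := fun k => if k = 0 then V else W
  obtain ⟨R, hR⟩ := exists_mem_L0_comp (iSup_le ℱ.le) T hG'
  refine ⟨R, hR.trans ?_, (Φ.map_borel T R _ hG' hR).trans ?_⟩
  · filter_upwards [hV, hW] with ω hVω hWω
    exact (congrArg G (Prod.ext hVω hWω)).trans (congrFun hGg (X ω, Y ω))
  · filter_upwards [hV', hW'] with ω hVω hWω
    exact (congrArg G (Prod.ext hVω hWω)).trans (congrFun hGg (X' ω, Y' ω))

end FilteredIso.Corresponds

theorem FilteredIso.exists_corresponds [IsProbabilityMeasure μ] (Φ : FilteredIso μ ℱ μ' ℱ') {n : ι}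
    {X : Ω → E} (hX : Measurable[ℱ n] X) :
    ∃ X' : Ω' → E, Measurable[ℱ' n] X' ∧ Φ.Corresponds X X' := by
  have hc := measurableEmbedding_embeddingReal E
  obtain ⟨ω₀⟩ : Nonempty Ω := nonempty_of_isProbabilityMeasure μ
  obtain ⟨d, hd, hdc⟩ := hc.exists_measurable_extend measurable_id fun _ => ⟨X ω₀⟩
  have hcX : StronglyMeasurable[ℱ n] fun ω => embeddingReal E (X ω) :=
    (hc.measurable.comp hX).stronglyMeasurable
  obtain ⟨V, hV⟩ := exists_mem_L0 (iSup_le ℱ.le)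
    (hcX.mono (le_iSup (fun n => (ℱ n : MeasurableSpace Ω)) n)).aestronglyMeasurable (μ := μ)
  obtain ⟨D, hD, hVD⟩ := (Φ.map_filtration n V).2 ⟨_, hcX, hV⟩
  -- `V` takes its values in the range of the embedding, hence so does its image.
  have hrange := Φ.map_borel (fun _ => V) V (fun s => embeddingReal E (d (s 0)))
    (hc.measurable.comp (hd.comp (measurable_pi_apply 0))) (by
      filter_upwards [hV] with ω hω
      rw [hω]
      exact congrArg _ (congrFun hdc (X ω)).symm)
  refine ⟨fun ω => d (D ω), hd.comp hD.measurable, V, hV, ?_⟩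
  filter_upwards [hrange, hVD] with ω hω hDω
  rw [hω, hDω]

theorem FilteredIso.Corresponds.hasTransition [IsProbabilityMeasure μ']
    {Φ : FilteredIso μ ℱ μ' ℱ'} {X : Ω → E} {X' : Ω' → E} {Y : Ω → E'} {Y' : Ω' → E'}
    {p : E → E' → ℝ} {n : ι} (hX : Φ.Corresponds X X') (hY : Φ.Corresponds Y Y')
    (h : HasTransition μ (ℱ n) X Y p) : HasTransition μ' (ℱ' n) X' Y' p := by
  intro B' hB' x y
  obtain ⟨P, hP, hBP⟩ := Φ.symm.exists_corresponds ((@measurable_mem _ B' (ℱ' n)).2 hB')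
  have hXB := hBP.symm.comp₂ hX measurable_id
  have hXBY := hXB.comp₂ hY measurable_id
  have hSx : MeasurableSet {q : Prop × E | q.1 ∧ q.2 = x} :=
    (measurableSet_setOfPred.2 measurable_fst).inter (measurable_snd (measurableSet_singleton x))
  have hSxy : MeasurableSet {q : (Prop × E) × E' | (q.1.1 ∧ q.1.2 = x) ∧ q.2 = y} :=
    (measurable_fst hSx).inter (measurable_snd (measurableSet_singleton y))
  have hB := congrArg ENNReal.toReal (hXB.measure_preimage_eq hSx)
  have hBy := congrArg ENNReal.toReal (hXBY.measure_preimage_eq hSxy)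
  have hP' : MeasurableSet[ℱ n] {ω | P ω} := (@measurableSet_setOfPred _ (ℱ n) P).2 hP
  exact hBy.trans ((h _ hP' x y).trans (congrArg (· * p x y) hB.symm))

end Isomorphism

section Transport

variable {Ω E E' : Type*} {m mΩ : MeasurableSpace Ω} {μ : Measure Ω} {X : Ω → E} {Y : Ω → E'}
  {p : E → E' → ℝ}

theorem HasTransition.congr_ae {X' : Ω → E} {Y' : Ω → E'} (h : HasTransition μ m X Y p)
    (hX : X =ᵐ[μ] X') (hY : Y =ᵐ[μ] Y') : HasTransition μ m X' Y' p := by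
  intro B hB x y
  have hBX := (ae_eq_refl B).inter (hX.preimage {x})
  rw [← measureReal_congr (hBX.inter (hY.preimage {y})), ← measureReal_congr hBX]
  exact h B hB x y

theorem HasTransition.map {Ω' : Type*} {m' mΩ' : MeasurableSpace Ω'} {T : Ω → Ω'} {X : Ω' → E}
    {Y : Ω' → E'} [MeasurableSpace E] [MeasurableSingletonClass E] [MeasurableSpace E']
    [MeasurableSingletonClass E'] (hm' : m' ≤ mΩ') (hT : Measurable[mΩ] T)
    (hX : Measurable[mΩ'] X) (hY : Measurable[mΩ'] Y)
    (h : HasTransition μ (m'.comap T) (X ∘ T) (Y ∘ T) p) : HasTransition (μ.map T) m' X Y p := by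
  intro B hB x y
  have hBX := (hm' B hB).inter (hX (measurableSet_singleton x))
  rw [map_measureReal_apply hT (hBX.inter (hY (measurableSet_singleton y))),
    map_measureReal_apply hT hBX]
  exact h _ ⟨B, hB, rfl⟩ x y

theorem HasTransition.of_immersed {ι : Type*} [Preorder ι] {ℱ 𝒢 : Filtration ι mΩ}
    [IsFiniteMeasure μ] [Finite E] [MeasurableSpace E] [MeasurableSingletonClass E]
    [MeasurableSpace E'] [MeasurableSingletonClass E'] (him : Immersed μ ℱ 𝒢) {m n : ι}
    (hmn : m ≤ n) (hX : Measurable[ℱ m] X) (hY : Measurable[ℱ n] Y)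
    (h : HasTransition μ (ℱ m) X Y p) : HasTransition μ (𝒢 m) X Y p := by
  intro B hB x y
  have hle : ℱ m ≤ mΩ := ℱ.le m
  have hx : MeasurableSet[ℱ m] (X ⁻¹' {x}) := hX (measurableSet_singleton x)
  have hy : MeasurableSet[ℱ n] (Y ⁻¹' {y}) := hY (measurableSet_singleton y)
  have hcond : μ[(Y ⁻¹' {y}).indicator (fun _ => (1 : ℝ)) | ℱ m] =ᵐ[μ] fun ω => p (X ω) y :=
    condExp_indicator_ae_eq (q := fun x => p x y) hle hX (ℱ.le n _ hy) fun B hB x => h B hB x y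
  have hint : ∀ A, MeasurableSet A →
      ∫ ω in X ⁻¹' {x}, (μ[A.indicator (fun _ => (1 : ℝ)) | ℱ m]) ω ∂μ =
        μ.real (X ⁻¹' {x} ∩ A) := fun A hA => by
    rw [setIntegral_condExp hle ((integrable_const _).indicator hA) hx, setIntegral_indicator hA,
      setIntegral_const, smul_eq_mul, mul_one]
  calc μ.real (B ∩ X ⁻¹' {x} ∩ Y ⁻¹' {y}) = μ.real (X ⁻¹' {x} ∩ (Y ⁻¹' {y} ∩ B)) := by
        rw [inter_comm B, inter_assoc, inter_comm B]
    _ = ∫ ω in X ⁻¹' {x}, (μ[B.indicator (fun _ => (1 : ℝ)) | ℱ m]) ω * p x y ∂μ := by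
        rw [← hint _ ((ℱ.le n _ hy).inter (𝒢.le m _ hB))]
        refine setIntegral_congr_ae (hle _ hx) ?_
        filter_upwards [him.2 m n hmn _ B hy hB, hcond] with ω hω hpω hxω
        rw [hω, Pi.mul_apply, hpω, show X ω = x from hxω, mul_comm]
    _ = μ.real (B ∩ X ⁻¹' {x}) * p x y := by
        rw [integral_mul_const, hint B (𝒢.le m _ hB), inter_comm]

theorem exists_measurable_ae_eq_of_completed [Countable E] [Nonempty E] [MeasurableSpace E]
    [MeasurableSingletonClass E] (hX : Measurable[completed μ m] X) :
    ∃ X' : Ω → E, Measurable[m] X' ∧ X =ᵐ[μ] X' := by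
  have hex : ∀ x, ∃ t, MeasurableSet[m] t ∧ (X ⁻¹' {x} : Set Ω) =ᵐ[μ] t := fun x =>
    (measurableSet_completed_iff.1 (hX (measurableSet_singleton x))).1
  choose t ht hXt using hex
  obtain ⟨X', hX', hX't⟩ := @exists_measurable_piecewise _ _ m _ _ _ _
    (fun x => t x \ ⋃ y ∈ ({x}ᶜ : Set E), t y)
    (fun x => @MeasurableSet.diff _ m _ _ (ht x) (.biUnion (to_countable _) fun y _ => ht y))
      (fun x _ => x)
    (fun _ => measurable_const) fun x y hxy ω hω =>
      (hω.2.2 (mem_biUnion (mem_compl_singleton_iff.2 hxy) hω.1.1)).elim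
  refine ⟨X', hX', ?_⟩
  filter_upwards [ae_all_iff.2 fun x => (hXt x).mem_iff] with ω hω
  refine (hX't (X ω) ⟨(hω _).1 rfl, fun hmem => ?_⟩).symm
  obtain ⟨y, hy, hωy⟩ := mem_iUnion₂.1 hmem
  exact hy ((hω y).2 hωy).symm

theorem comap_path_piLE {κ : Type*} [Preorder κ] (V : κ → Ω → ℝ) (i : κ) :
    MeasurableSpace.comap (fun ω i => V i ω) (Filtration.piLE (X := fun _ : κ => ℝ) i) =
      ⨆ k : Set.Iic i, MeasurableSpace.comap (V k) inferInstance := by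
  change MeasurableSpace.comap _ (MeasurableSpace.comap _ MeasurableSpace.pi) = _
  rw [MeasurableSpace.comap_comp, MeasurableSpace.pi, MeasurableSpace.comap_iSup]
  exact iSup_congr fun k => by rw [MeasurableSpace.comap_comp]; rfl

end Transport

/-- A process `X`, read at the decreasing times `j 0 ≥ j 1 ≥ …` of the filtration `ℱ`, in which
`X k` determines a variable `f k (X k)` whose conditional law given the past of `X (k + 1)` is
`p k (X (k + 1))`, and in which no value is taken with probability more than `1 / 2`. In a chain of
bricks, `X k` is a middle variable of a brick and `f k (X k)` is the last variable of the previous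
one. -/
structure IsBackwardChain {Ω κ : Type*} {mΩ : MeasurableSpace Ω} [Preorder κ] (μ : Measure Ω)
    (ℱ : Filtration κ mΩ) (j : ℕ → κ) {G E : ℕ → Type*} [∀ k, MeasurableSpace (G k)]
    (f : ∀ k, G k → E k) (p : ∀ k, G (k + 1) → E k → ℝ) (X : ∀ k, Ω → G k) : Prop where
  meas : ∀ k, Measurable[ℱ (j k)] (X k)
  trans : ∀ k, HasTransition μ (ℱ (j (k + 1))) (X (k + 1)) (fun ω => f k (X k ω)) (p k)
  bound : ∀ k x, μ.real (X k ⁻¹' {x}) ≤ 1 / 2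

section BackwardChain

variable {Ω κ : Type*} {mΩ : MeasurableSpace Ω} [Preorder κ] {μ : Measure Ω}
  [IsProbabilityMeasure μ] {ℱ : Filtration κ mΩ} {j : ℕ → κ} {G E : ℕ → Type*} [∀ k, Finite (G k)]
  [∀ k, MeasurableSpace (G k)] [∀ k, MeasurableSingletonClass (G k)]
  [∀ k, MeasurableSpace (E k)] [∀ k, MeasurableSingletonClass (E k)] {f : ∀ k, G k → E k}
  {p : ∀ k, G (k + 1) → E k → ℝ} {X : ∀ k, Ω → G k}

theorem IsBackwardChain.exists_of_filteredIso {Ω' : Type*} {mΩ' : MeasurableSpace Ω'}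
    {μ' : Measure Ω'} [IsProbabilityMeasure μ'] {ℱ' : Filtration κ mΩ'} [∀ k, Countable (E k)]
    (h : IsBackwardChain μ ℱ j f p X) (Φ : FilteredIso μ ℱ μ' ℱ') :
    ∃ X', IsBackwardChain μ' ℱ' j f p X' := by
  choose X' hX' hXX' using fun k => Φ.exists_corresponds (h.meas k)
  refine ⟨X', hX', fun k => ?_, fun k x => ?_⟩
  · exact (hXX' (k + 1)).hasTransition ((hXX' k).comp₂ (hXX' k)
      ((measurable_of_countable (f k)).comp measurable_fst)) (h.trans k)
  · rw [measureReal_def, (hXX' k).measure_preimage_eq (measurableSet_singleton x)]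
    exact h.bound k x

theorem IsBackwardChain.of_immersed {𝒢 : Filtration κ mΩ} (hj : Antitone j)
    (h : IsBackwardChain μ ℱ j f p X) (him : Immersed μ ℱ 𝒢) : IsBackwardChain μ 𝒢 j f p X where
  meas k := (h.meas k).mono (him.1 _) le_rfl
  trans k := (h.trans k).of_immersed him (hj k.le_succ) (h.meas _)
    ((measurable_of_countable (f k)).comp (h.meas k))
  bound := h.bound

theorem IsBackwardChain.exists_path {V : κ → Ω → ℝ} (hV : ∀ i, Measurable (V i))
    (h : IsBackwardChain μ (naturalFiltration μ V) j f p X) :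
    ∃ Y, IsBackwardChain (μ.map fun ω i => V i ω) Filtration.piLE j f p Y := by
  obtain ⟨ω₀⟩ : Nonempty Ω := nonempty_of_isProbabilityMeasure μ
  have hT : Measurable fun ω i => V i ω := measurable_pi_lambda _ hV
  have hex : ∀ k, ∃ Y : (κ → ℝ) → G k, Measurable[Filtration.piLE (j k)] Y ∧
      X k =ᵐ[μ] fun ω => Y fun i => V i ω := by
    intro k
    have : Nonempty (G k) := ⟨X k ω₀⟩
    have hX := h.meas k
    rw [naturalFiltration_apply, ← comap_path_piLE] at hX
    obtain ⟨X', hX', hXX'⟩ := exists_measurable_ae_eq_of_completed hX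
    obtain ⟨Y, hY, rfl⟩ := Measurable.exists_eq_measurable_comp (mY := Filtration.piLE (j k))
      hX'
    exact ⟨Y, hY, hXX'⟩
  choose Y hY hXY using hex
  have hY' : ∀ k, Measurable (Y k) := fun k => (hY k).mono (Filtration.le _ _) le_rfl
  refine ⟨Y, hY, fun k => ?_, fun k x => ?_⟩
  · have hle : MeasurableSpace.comap (fun ω i => V i ω) (Filtration.piLE (j (k + 1))) ≤
        naturalFiltration μ V (j (k + 1)) := by
      rw [comap_path_piLE]
      exact le_completed (iSup_le fun i => (hV i).comap_le)
    exact (((h.trans k).mono hle).congr_ae (hXY _) ((hXY k).fun_comp (f k))).map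
      (Filtration.le _ _) hT (hY' _) ((measurable_of_countable (f k)).comp (hY' k))
  · rw [map_measureReal_apply hT (hY' k (measurableSet_singleton x))]
    exact (measureReal_congr ((hXY k).preimage {x})).symm.trans_le (h.bound k x)

end BackwardChain

section Resampling

variable {Ω Ω' E E' : Type*} {m mΩ : MeasurableSpace Ω} {mΩ' : MeasurableSpace Ω'} {μ : Measure Ω}
  {ν : Measure Ω'} {p : E → E' → ℝ}

theorem HasTransition.real_inter_eq_le [IsFiniteMeasure μ] [Fintype E'] {X : Ω → E}
    {Y Y' : Ω → E'} {p' : E → E' → ℝ} (h : HasTransition μ m X Y p)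
    (h' : HasTransition μ m X Y' p') {B : Set Ω} (hB : MeasurableSet[m] B) (x : E) :
    μ.real (B ∩ X ⁻¹' {x} ∩ {ω | Y ω = Y' ω}) ≤
      μ.real (B ∩ X ⁻¹' {x}) * ∑ y, min (p x y) (p' x y) := by
  set A := B ∩ X ⁻¹' {x}
  have hcover : A ∩ {ω | Y ω = Y' ω} ⊆
      ⋃ y ∈ Finset.univ, (A ∩ Y ⁻¹' {y} ∩ (A ∩ Y' ⁻¹' {y}) : Set Ω) := fun ω ⟨hω, heq⟩ =>
    mem_iUnion₂.2 ⟨Y ω, Finset.mem_univ _, ⟨hω, rfl⟩, hω, Eq.symm heq⟩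
  rw [Finset.mul_sum]
  refine ((measureReal_mono hcover (measure_ne_top μ _)).trans
    (measureReal_biUnion_finset_le _ _)).trans (Finset.sum_le_sum fun y _ => ?_)
  rw [mul_min_of_nonneg _ _ measureReal_nonneg, ← h B hB, ← h' B hB]
  exact le_min (measureReal_mono inter_subset_left) (measureReal_mono inter_subset_right)

variable [MeasurableSpace E] [MeasurableSingletonClass E]

theorem measureReal_prod_apply [IsFiniteMeasure μ] [IsFiniteMeasure ν] {S : Set (Ω' × Ω)}
    (hS : MeasurableSet S) :
    (ν.prod μ).real S = ∫ a, μ.real (Prod.mk a ⁻¹' S) ∂ν := by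
  rw [measureReal_def, Measure.prod_apply hS, ← integral_toReal
    (measurable_measure_prodMk_left hS).aemeasurable (ae_of_all _ fun a => measure_lt_top _ _)]
  rfl

theorem HasTransition.prod [IsFiniteMeasure μ] [IsFiniteMeasure ν] [MeasurableSpace E']
    [MeasurableSingletonClass E'] {m₀ : MeasurableSpace (Ω' × Ω)} {X : Ω → E} {Y : Ω → E'}
    (h : HasTransition μ m X Y p) (hX : Measurable[mΩ] X) (hY : Measurable[mΩ] Y)
    (hm₀ : m₀ ≤ mΩ'.prod mΩ) (hsection : ∀ a, Measurable[m, m₀] (Prod.mk a)) :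
    HasTransition (ν.prod μ) m₀ (fun q => X q.2) (fun q => Y q.2) p := by
  intro B hB x y
  have hBX := (hm₀ B hB).inter (hX.comp measurable_snd (measurableSet_singleton x))
  have hBXY := hBX.inter (hY.comp measurable_snd (measurableSet_singleton y))
  refine (measureReal_prod_apply hBXY).trans
    (Eq.trans ?_ (congrArg (· * p x y) (measureReal_prod_apply hBX)).symm)
  rw [← integral_mul_const]
  exact integral_congr_ae (ae_of_all _ fun a => h _ (hsection a hB) x y)

theorem HasTransition.real_ne_and_eq_le [IsProbabilityMeasure μ] [Finite E] [Fintype E']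
    {X X' : Ω → E} {Y Y' : Ω → E'} (hX : Measurable X) (hX' : Measurable X')
    (h : HasTransition μ (MeasurableSpace.comap X' inferInstance) X Y p)
    (h' : HasTransition μ (MeasurableSpace.comap X inferInstance) X' Y' p) {ε : ℝ} (hε : 0 ≤ ε)
    (hp : ∀ x x', x ≠ x' → ∑ y, min (p x y) (p x' y) ≤ ε) :
    μ.real {ω | X ω ≠ X' ω ∧ Y ω = Y' ω} ≤ ε := by
  classical
  have := Fintype.ofFinite E
  set W : Ω → E × E := fun ω => (X ω, X' ω)
  have hW : Measurable W := hX.prodMk hX'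
  have hpre : ∀ x x', W ⁻¹' {(x, x')} = X ⁻¹' {x} ∩ X' ⁻¹' {x'} := fun x x' => by
    rw [← singleton_prod_singleton, mk_preimage_prod]
  have hleft : HasTransition μ ⊥ W Y fun x => p x.1 := by
    rintro B hB ⟨x, x'⟩ y
    rw [hpre, inter_comm (X ⁻¹' _), ← inter_assoc]
    exact h _ (.inter (bot_le (a := MeasurableSpace.comap X' _) _ hB)
      ⟨_, measurableSet_singleton x', rfl⟩) x y
  have hright : HasTransition μ ⊥ W Y' fun x => p x.2 := by
    rintro B hB ⟨x, x'⟩ y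
    rw [hpre, ← inter_assoc]
    exact h' _ (.inter (bot_le (a := MeasurableSpace.comap X _) _ hB)
      ⟨_, measurableSet_singleton x, rfl⟩) x' y
  have hcover : {ω | X ω ≠ X' ω ∧ Y ω = Y' ω} ⊆ ⋃ x ∈ Finset.univ.offDiag,
      (univ ∩ W ⁻¹' {x} ∩ {ω | Y ω = Y' ω} : Set Ω) := fun ω ⟨hne, heq⟩ =>
    mem_iUnion₂.2 ⟨W ω, Finset.mem_offDiag.2 ⟨Finset.mem_univ _, Finset.mem_univ _, hne⟩,
      ⟨mem_univ _, rfl⟩, heq⟩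
  calc μ.real {ω | X ω ≠ X' ω ∧ Y ω = Y' ω}
      ≤ ∑ x ∈ Finset.univ.offDiag, μ.real (univ ∩ W ⁻¹' {x} ∩ {ω | Y ω = Y' ω}) :=
        (measureReal_mono hcover (measure_ne_top μ _)).trans (measureReal_biUnion_finset_le _ _)
    _ ≤ ∑ x ∈ Finset.univ.offDiag, μ.real (W ⁻¹' {x}) * ε := by
        refine Finset.sum_le_sum fun x hx =>
          (hleft.real_inter_eq_le hright MeasurableSet.univ x).trans ?_
        rw [univ_inter]
        exact mul_le_mul_of_nonneg_left (hp _ _ (Finset.mem_offDiag.1 hx).2.2) measureReal_nonneg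
    _ ≤ ε := by
        rw [← Finset.sum_mul,
          sum_measureReal_preimage_singleton _ fun x _ => hW (measurableSet_singleton x)]
        exact mul_le_of_le_one_left hε measureReal_le_one

end Resampling

section PastCoupling

variable {κ : Type*} [LinearOrder κ]

/-- The path that follows `a` up to time `m` and `c` afterwards. -/
def mix (m : κ) (a c : κ → ℝ) : κ → ℝ :=
  fun i => if i ≤ m then a i else c i

theorem mix_mix (m : κ) (a b c : κ → ℝ) : mix m a (mix m b c) = mix m a c := by
  ext i
  simp only [mix]
  split_ifs <;> rfl

theorem measurable_mix (m : κ) : Measurable fun q : (κ → ℝ) × (κ → ℝ) => mix m q.1 q.2 := by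
  refine measurable_pi_lambda _ fun i => ?_
  simp only [mix]
  split_ifs
  · exact (measurable_pi_apply i).comp measurable_fst
  · exact (measurable_pi_apply i).comp measurable_snd

theorem measurable_piLE_mix (m i : κ) (a : κ → ℝ) :
    Measurable[Filtration.piLE (X := fun _ : κ => ℝ) i,
      Filtration.piLE (X := fun _ : κ => ℝ) i] (mix m a) := by
  refine measurable_comap_iff.2 (@measurable_pi_lambda _ _ _ (Filtration.piLE i) _ _ fun k => ?_)
  by_cases hk : (k : κ) ≤ m
  · have hconst : (fun c => mix m a c k) = fun _ => a k := funext fun c => if_pos hk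
    exact hconst ▸ measurable_const
  · have heval : (fun c => mix m a c k) = (fun w => w k) ∘ Preorder.restrictLe i :=
      funext fun c => if_neg hk
    exact heval ▸ (measurable_pi_apply k).comp (comap_measurable _)

variable (ρ : κ → Measure ℝ)

/-- The law of a pair of paths with independent coordinates which coincide after time `m` and whose
pasts up to time `m` are independent. It is encoded by resampling the past of the second path, which
makes the pair a function of two independent paths. -/
def pastCoupling (m : κ) : Measure ((κ → ℝ) × (κ → ℝ)) :=
  ((Measure.infinitePi ρ).prod (Measure.infinitePi ρ)).map fun q => (mix m q.1 q.2, q.2)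

theorem measurePreserving_pastCoupling (m : κ) :
    MeasurePreserving (fun q : (κ → ℝ) × (κ → ℝ) => (mix m q.1 q.2, q.2))
      ((Measure.infinitePi ρ).prod (Measure.infinitePi ρ)) (pastCoupling ρ m) :=
  ⟨(measurable_mix m).prodMk measurable_snd, rfl⟩

variable [∀ i, IsProbabilityMeasure (ρ i)]

theorem measurePreserving_mix (m : κ) :
    MeasurePreserving (fun q : (κ → ℝ) × (κ → ℝ) => mix m q.1 q.2)
      ((Measure.infinitePi ρ).prod (Measure.infinitePi ρ)) (Measure.infinitePi ρ) := by
  refine ⟨measurable_mix m, Measure.eq_infinitePi _ fun s t ht => ?_⟩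
  have hpre : (fun q : (κ → ℝ) × (κ → ℝ) => mix m q.1 q.2) ⁻¹' (Set.pi s t) =
      (Set.pi (s.filter (· ≤ m)) t) ×ˢ (Set.pi (s.filter (¬ · ≤ m)) t) := by
    ext q
    simp only [mem_preimage, Set.mem_pi, mem_prod, Finset.coe_filter, mem_ofPred_eq, mix,
      Finset.mem_coe, ← forall_and]
    refine forall_congr' fun i => ?_
    by_cases hi : i ≤ m <;> simp [hi]
  rw [Measure.map_apply (measurable_mix m) (MeasurableSet.pi s.countable_toSet fun i _ => ht i),
    hpre, Measure.prod_prod, Measure.infinitePi_pi _ fun i _ => ht i,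
    Measure.infinitePi_pi _ fun i _ => ht i, Finset.prod_filter_mul_prod_filter_not]

instance (m : κ) : IsProbabilityMeasure (pastCoupling ρ m) :=
  Measure.isProbabilityMeasure_map (measurePreserving_pastCoupling ρ m).aemeasurable

theorem measurePreserving_mix_mix (m : κ) :
    MeasurePreserving (fun q : ((κ → ℝ) × (κ → ℝ)) × (κ → ℝ) => (mix m q.1.1 q.2, mix m q.1.2 q.2))
      (((Measure.infinitePi ρ).prod (Measure.infinitePi ρ)).prod (Measure.infinitePi ρ))
      (pastCoupling ρ m) := by
  convert (measurePreserving_pastCoupling ρ m).comp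
    (((MeasurePreserving.id (Measure.infinitePi ρ)).prod (measurePreserving_mix ρ m)).comp
      (measurePreserving_prodAssoc _ _ _)) using 1
  ext1 q
  exact congrArg (·, _) (mix_mix m _ _ _).symm

theorem measurePreserving_swap_pastCoupling (m : κ) :
    MeasurePreserving Prod.swap (pastCoupling ρ m) (pastCoupling ρ m) := by
  refine ⟨measurable_swap, ?_⟩
  have hswap := (measurePreserving_mix_mix ρ m).comp
    ((Measure.measurePreserving_swap (μ := Measure.infinitePi ρ)
      (ν := Measure.infinitePi ρ)).prod (MeasurePreserving.id (Measure.infinitePi ρ)))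
  conv_lhs => rw [← (measurePreserving_mix_mix ρ m).map_eq]
  rw [Measure.map_map measurable_swap (measurePreserving_mix_mix ρ m).measurable]
  exact hswap.map_eq

theorem measurePreserving_fst_pastCoupling (m : κ) :
    MeasurePreserving Prod.fst (pastCoupling ρ m) (Measure.infinitePi ρ) := by
  refine ⟨measurable_fst, ?_⟩
  rw [pastCoupling, Measure.map_map measurable_fst (measurePreserving_pastCoupling ρ m).measurable]
  exact (measurePreserving_mix ρ m).map_eq

theorem measurePreserving_snd_pastCoupling (m : κ) :
    MeasurePreserving Prod.snd (pastCoupling ρ m) (Measure.infinitePi ρ) :=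
  (measurePreserving_fst_pastCoupling ρ m).comp (measurePreserving_swap_pastCoupling ρ m)

end PastCoupling

section Coincidence

variable {κ : Type*} [LinearOrder κ] (ρ : κ → Measure ℝ)

theorem pastCoupling_symmDiff_cylinder {m : κ} {I : Finset κ} (hI : ∀ i ∈ I, m < i)
    {S : Set (I → ℝ)} (hS : MeasurableSet S) :
    (pastCoupling ρ m).real (symmDiff (Prod.fst ⁻¹' cylinder (α := fun _ => ℝ) I S)
      (Prod.snd ⁻¹' cylinder (α := fun _ => ℝ) I S)) = 0 := by
  have hB := hS.cylinder (α := fun _ => ℝ) I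
  rw [← (measurePreserving_pastCoupling ρ m).measureReal_preimage
    ((measurable_fst hB).symmDiff (measurable_snd hB)).nullMeasurableSet]
  have hpre : (fun q : (κ → ℝ) × (κ → ℝ) => (mix m q.1 q.2, q.2)) ⁻¹'
      (Prod.fst ⁻¹' cylinder (α := fun _ => ℝ) I S) =
      Prod.snd ⁻¹' cylinder (α := fun _ => ℝ) I S := ext fun q => by
    have hrestrict : I.restrict (mix m q.1 q.2) = I.restrict q.2 :=
      funext fun i => if_neg (not_le.2 (hI i i.2))
    simp only [mem_preimage, mem_cylinder, hrestrict]
  rw [preimage_symmDiff, hpre]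
  exact (congrArg _ (symmDiff_self _)).trans measureReal_empty

variable [∀ i, IsProbabilityMeasure (ρ i)]

theorem tendsto_pastCoupling_symmDiff {ι : Type*} {l : Filter ι} {j : ι → κ}
    (hj : ∀ i, ∀ᶠ n in l, j n < i) {A : Set (κ → ℝ)} (hA : MeasurableSet A) :
    Tendsto (fun n => (pastCoupling ρ (j n)).real (symmDiff (Prod.fst ⁻¹' A) (Prod.snd ⁻¹' A)))
      l (nhds 0) := by
  have hdense := Measure.MeasureDense.of_generateFrom_isSetAlgebra_finite
    (μ := Measure.infinitePi ρ) (isSetAlgebra_measurableCylinders (α := fun _ : κ => ℝ))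
    (generateFrom_measurableCylinders (α := fun _ : κ => ℝ)).symm
  refine tendsto_order.2 ⟨fun δ hδ => .of_forall fun n => hδ.trans_le measureReal_nonneg,
    fun δ hδ => ?_⟩
  obtain ⟨B, hB, hAB⟩ := hdense.approx A hA (measure_ne_top _ _) (δ / 2) (half_pos hδ)
  replace hAB : (Measure.infinitePi ρ).real (symmDiff A B) < δ / 2 :=
    (ENNReal.lt_ofReal_iff_toReal_lt (measure_ne_top _ _)).1 hAB
  have hABm := (hA.symmDiff (hdense.measurable B hB)).nullMeasurableSet (μ := Measure.infinitePi ρ)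
  obtain ⟨I, S, hS, rfl⟩ := (mem_measurableCylinders _).1 hB
  filter_upwards [(I.eventually_all).2 fun i _ => hj i] with n hn
  set B := cylinder (α := fun _ => ℝ) I S
  have hfst := (measurePreserving_fst_pastCoupling ρ (j n)).measureReal_preimage hABm
  have hsnd := (measurePreserving_snd_pastCoupling ρ (j n)).measureReal_preimage hABm
  rw [preimage_symmDiff] at hfst
  rw [preimage_symmDiff, symmDiff_comm] at hsnd
  calc (pastCoupling ρ (j n)).real (symmDiff (Prod.fst ⁻¹' A) (Prod.snd ⁻¹' A))
      ≤ (pastCoupling ρ (j n)).real (symmDiff (Prod.fst ⁻¹' A) (Prod.fst ⁻¹' B)) +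
        ((pastCoupling ρ (j n)).real (symmDiff (Prod.fst ⁻¹' B) (Prod.snd ⁻¹' B)) +
          (pastCoupling ρ (j n)).real (symmDiff (Prod.snd ⁻¹' B) (Prod.snd ⁻¹' A))) :=
        (measureReal_symmDiff_le _).trans (add_le_add_right (measureReal_symmDiff_le _) _)
    _ < δ := by
        rw [pastCoupling_symmDiff_cylinder ρ hn hS, hfst, hsnd]
        linarith

theorem tendsto_pastCoupling_ne {G ι : Type*} [Finite G] [MeasurableSpace G]
    [MeasurableSingletonClass G] {l : Filter ι} {j : ι → κ} (hj : ∀ i, ∀ᶠ n in l, j n < i)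
    {Y : (κ → ℝ) → G} (hY : Measurable Y) :
    Tendsto (fun n => (pastCoupling ρ (j n)).real {w | Y w.1 ≠ Y w.2}) l (nhds 0) := by
  have := Fintype.ofFinite G
  have hlim := tendsto_finsetSum Finset.univ fun y _ =>
    tendsto_pastCoupling_symmDiff ρ hj (hY (measurableSet_singleton y))
  rw [Finset.sum_const_zero] at hlim
  refine squeeze_zero (fun n => measureReal_nonneg) (fun n => ?_) hlim
  refine (measureReal_mono ?_ (measure_ne_top _ _)).trans (measureReal_biUnion_finset_le _ _)
  exact fun w hw => mem_iUnion₂.2 ⟨Y w.1, Finset.mem_univ _, Or.inl ⟨rfl, Ne.symm hw⟩⟩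

end Coincidence

section CoupledChains

variable {κ : Type*} [LinearOrder κ] {ρ : κ → Measure ℝ} [∀ i, IsProbabilityMeasure (ρ i)]

theorem half_le_real_pastCoupling_ne {G : Type*} [Finite G] [MeasurableSpace G]
    [MeasurableSingletonClass G] {m : κ} {Y : (κ → ℝ) → G}
    (hY : Measurable[Filtration.piLE (X := fun _ : κ => ℝ) m] Y)
    (hbound : ∀ x, (Measure.infinitePi ρ).real (Y ⁻¹' {x}) ≤ 1 / 2) :
    1 / 2 ≤ (pastCoupling ρ m).real {w | Y w.1 ≠ Y w.2} := by
  have := Fintype.ofFinite G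
  set ν := Measure.infinitePi ρ
  have hY' : Measurable Y := hY.mono (Filtration.le _ _) le_rfl
  have hne : MeasurableSet {w : (κ → ℝ) × (κ → ℝ) | Y w.1 = Y w.2} :=
    measurableSet_eq_fun (hY'.comp measurable_fst) (hY'.comp measurable_snd)
  have hpre : (fun q : (κ → ℝ) × (κ → ℝ) => (mix m q.1 q.2, q.2)) ⁻¹' {w | Y w.1 = Y w.2} =
      ⋃ x ∈ Finset.univ, (Y ⁻¹' {x}) ×ˢ (Y ⁻¹' {x}) := by
    ext q
    have hmix : Y (mix m q.1 q.2) = Y q.1 := hY.dependsOn_of_piLE fun i hi => if_pos hi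
    simp [hmix, eq_comm]
  have heq : (pastCoupling ρ m).real {w | Y w.1 = Y w.2} ≤ 1 / 2 := by
    rw [← (measurePreserving_pastCoupling ρ m).measureReal_preimage hne.nullMeasurableSet, hpre]
    calc (ν.prod ν).real (⋃ x ∈ Finset.univ, (Y ⁻¹' {x}) ×ˢ (Y ⁻¹' {x}))
        ≤ ∑ x, ν.real (Y ⁻¹' {x}) * ν.real (Y ⁻¹' {x}) := by
          refine (measureReal_biUnion_finset_le _ _).trans_eq ?_
          exact Finset.sum_congr rfl fun x _ => measureReal_prod_prod _ _
      _ ≤ ∑ x, ν.real (Y ⁻¹' {x}) * (1 / 2) := Finset.sum_le_sum fun x _ =>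
          mul_le_mul_of_nonneg_left (hbound x) measureReal_nonneg
      _ = 1 / 2 := by
          rw [← Finset.sum_mul, sum_measureReal_preimage_singleton _ fun x _ =>
            hY' (measurableSet_singleton x), Finset.coe_univ, preimage_univ, probReal_univ, one_mul]
  have hcompl := probReal_compl_eq_one_sub (μ := pastCoupling ρ m) hne
  change _ ≤ (pastCoupling ρ m).real {w | Y w.1 = Y w.2}ᶜ
  linarith

theorem HasTransition.pastCoupling_snd {G E : Type*} [MeasurableSpace G]
    [MeasurableSingletonClass G] [MeasurableSpace E] [MeasurableSingletonClass E] {i : κ}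
    {X : (κ → ℝ) → G} {Y : (κ → ℝ) → E} {p : G → E → ℝ}
    (h : HasTransition (Measure.infinitePi ρ) (Filtration.piLE i) X Y p)
    (hX : Measurable[Filtration.piLE (X := fun _ : κ => ℝ) i] X) (hY : Measurable Y) (m : κ) :
    HasTransition (pastCoupling ρ m)
      (MeasurableSpace.comap (fun w => X w.1) inferInstance) (fun w => X w.2) (fun w => Y w.2)
      p := by
  have hX' : Measurable X := hX.mono (Filtration.le _ _) le_rfl
  refine HasTransition.map (hX'.comp measurable_fst).comap_le
    (measurePreserving_pastCoupling ρ m).measurable (hX'.comp measurable_snd)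
    (hY.comp measurable_snd) (h.prod hX' hY ?_ fun a => ?_)
  · rw [MeasurableSpace.comap_comp]
    exact (hX'.comp (measurable_mix m)).comap_le
  · rw [MeasurableSpace.comap_comp]
    exact measurable_comap_iff.2 (hX.comp (measurable_piLE_mix m i a))

theorem HasTransition.pastCoupling_fst {G E : Type*} [MeasurableSpace G]
    [MeasurableSingletonClass G] [MeasurableSpace E] [MeasurableSingletonClass E] {i : κ}
    {X : (κ → ℝ) → G} {Y : (κ → ℝ) → E} {p : G → E → ℝ}
    (h : HasTransition (Measure.infinitePi ρ) (Filtration.piLE i) X Y p)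
    (hX : Measurable[Filtration.piLE (X := fun _ : κ => ℝ) i] X) (hY : Measurable Y) (m : κ) :
    HasTransition (pastCoupling ρ m)
      (MeasurableSpace.comap (fun w => X w.2) inferInstance) (fun w => X w.1) (fun w => Y w.1)
      p := by
  have hX' : Measurable X := hX.mono (Filtration.le _ _) le_rfl
  rw [← (measurePreserving_swap_pastCoupling ρ m).map_eq]
  refine HasTransition.map (hX'.comp measurable_snd).comap_le measurable_swap
    (hX'.comp measurable_fst) (hY.comp measurable_fst) ?_
  rw [MeasurableSpace.comap_comp]
  exact h.pastCoupling_snd hX hY m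

variable {j : ℕ → κ} {G E : ℕ → Type*} [∀ k, Finite (G k)] [∀ k, MeasurableSpace (G k)]
  [∀ k, MeasurableSingletonClass (G k)] [∀ k, Fintype (E k)] [∀ k, MeasurableSpace (E k)]
  [∀ k, MeasurableSingletonClass (E k)] {f : ∀ k, G k → E k} {p : ∀ k, G (k + 1) → E k → ℝ}

theorem IsBackwardChain.real_pastCoupling_ne_succ_le {Y : ∀ k, (κ → ℝ) → G k}
    (h : IsBackwardChain (Measure.infinitePi ρ) Filtration.piLE j f p Y) (m : κ) {k : ℕ} {ε : ℝ}
    (hε : 0 ≤ ε) (hp : ∀ x x', x ≠ x' → ∑ z, min (p k x z) (p k x' z) ≤ ε) :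
    (pastCoupling ρ m).real {w | Y (k + 1) w.1 ≠ Y (k + 1) w.2} ≤
      (pastCoupling ρ m).real {w | Y k w.1 ≠ Y k w.2} + ε := by
  have hY : ∀ k, Measurable (Y k) := fun k => (h.meas k).mono (Filtration.le _ _) le_rfl
  have hfY : Measurable fun w => f k (Y k w) := (measurable_of_countable (f k)).comp (hY k)
  have hmeet := HasTransition.real_ne_and_eq_le ((hY _).comp measurable_fst)
    ((hY _).comp measurable_snd) ((h.trans k).pastCoupling_fst (h.meas _) hfY m)
    ((h.trans k).pastCoupling_snd (h.meas _) hfY m) hε hp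
  refine le_trans (measureReal_mono (fun w hw => ?_) (measure_ne_top _ _))
    ((measureReal_union_le _ _).trans (add_le_add_right hmeet _))
  by_cases heq : Y k w.1 = Y k w.2
  · exact Or.inr ⟨hw, congrArg (f k) heq⟩
  · exact Or.inl heq

theorem not_isBackwardChain_infinitePi {Y : ∀ k, (κ → ℝ) → G k} (hj : ∀ i, ∀ᶠ n in atTop, j n < i)
    {ε : ℕ → ℝ} (hε : ∀ k, 0 ≤ ε k) (hsum : ∀ n, ∑ k ∈ Finset.range n, ε k ≤ 1 / 4)
    (hp : ∀ k x x', x ≠ x' → ∑ z, min (p k x z) (p k x' z) ≤ ε k) :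
    ¬ IsBackwardChain (Measure.infinitePi ρ) Filtration.piLE j f p Y := by
  intro h
  obtain ⟨n, hn⟩ := ((tendsto_pastCoupling_ne ρ hj ((h.meas 0).mono (Filtration.le _ _)
    le_rfl)).eventually_lt_const (show (0 : ℝ) < 1 / 4 by norm_num)).exists
  have hstep : ∀ k, (pastCoupling ρ (j n)).real {w | Y k w.1 ≠ Y k w.2} ≤
      (pastCoupling ρ (j n)).real {w | Y 0 w.1 ≠ Y 0 w.2} + ∑ i ∈ Finset.range k, ε i := by
    intro k
    induction k with
    | zero => simp
    | succ k ih =>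
      have := h.real_pastCoupling_ne_succ_le (j n) (hε k) (hp k)
      rw [Finset.sum_range_succ]
      linarith
  linarith [hstep n, half_le_real_pastCoupling_ne (h.meas n) (h.bound n), hsum n]

theorem IsBackwardChain.not_isStandard {Ω : Type*} {mΩ : MeasurableSpace Ω} {μ : Measure Ω}
    [IsProbabilityMeasure μ] {ℱ : Filtration κ mΩ} {X : ∀ k, Ω → G k}
    (h : IsBackwardChain μ ℱ j f p X) (hj : Antitone j) (hj' : ∀ i, ∃ n, j n < i) {ε : ℕ → ℝ}
    (hε : ∀ k, 0 ≤ ε k) (hsum : ∀ n, ∑ k ∈ Finset.range n, ε k ≤ 1 / 4)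
    (hp : ∀ k x x', x ≠ x' → ∑ z, min (p k x z) (p k x' z) ≤ ε k) : ¬ IsStandard μ ℱ := by
  rintro ⟨Ω', mΩ', μ', ℱ', 𝒢, hμ', ⟨V, hV, hind, rfl⟩, ⟨Φ⟩, him⟩
  obtain ⟨X', hX'⟩ := h.exists_of_filteredIso Φ
  obtain ⟨Y, hY⟩ := (hX'.of_immersed hj him).exists_path hV
  rw [(iIndepFun_iff_map_fun_eq_infinitePi_map hV).1 hind] at hY
  have := fun i => Measure.isProbabilityMeasure_map (μ := μ') (hV i).aemeasurable
  refine not_isBackwardChain_infinitePi (fun i => ?_) hε hsum hp hY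
  obtain ⟨n, hn⟩ := hj' i
  exact (eventually_ge_atTop n).mono fun n' hn' => (hj hn').trans_lt hn

end CoupledChains

section Bricks

variable {Ω : Type*} {mΩ : MeasurableSpace Ω} {μ : Measure Ω} {F : ℤ → Type*}
  [∀ n, Fintype (F n)] [∀ n, MeasurableSpace (F n)] {Z : ∀ n, Ω → F n} {r : ℤ → ℕ} {α : ℤ → ℝ}

theorem IsBrickChain.sum_min_condProb_le (h : IsBrickChain μ Z r α) {m i n : ℤ} (hn : n ≤ 0)
    (hm : m = 2 * n - 1) (hi : i = 2 * n) {x x' : F m} (hx : x ≠ x') :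
    ∑ z, min (condProb μ (Z i) (Z m) z x) (condProb μ (Z i) (Z m) z x') ≤ α n := by
  subst hm hi
  exact (h.brick n hn).overlap x x' hx

theorem exists_sum_range_le {a : ℕ → ℝ} (ha : Summable a) (ha0 : ∀ k, 0 ≤ a k) {δ : ℝ}
    (hδ : 0 < δ) (K : ℕ) : ∃ M ≥ K, ∀ n, ∑ k ∈ Finset.range n, a (k + M) ≤ δ := by
  obtain ⟨M, hM, hMK⟩ :=
    (((tendsto_sum_nat_add a).eventually_lt_const hδ).and (eventually_ge_atTop K)).exists
  exact ⟨M, hMK, fun n => (((summable_nat_add_iff M).2 ha).sum_le_tsum _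
    fun k _ => ha0 _).trans hM.le⟩

variable [∀ n, MeasurableSingletonClass (F n)] [IsProbabilityMeasure μ]

theorem IsBrickChain.hasTransition_of_eq (h : IsBrickChain μ Z r α) {m i n : ℤ} (hn : n ≤ 0)
    (hm : m = 2 * n - 1) (hi : i = 2 * n) : HasTransition μ (naturalFiltration μ Z m) (Z m) (Z i)
      fun x z => condProb μ (Z i) (Z m) z x := by
  subst hm hi
  exact h.hasTransition_even hn

variable {κ : Type*} [LinearOrder κ] {φ : κ → ℤ}

theorem IsBrickChain.exists_isBackwardChain (h : IsBrickChain μ Z r α)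
    (hF : ∀ n ≤ 0, 2 ≤ Fintype.card (F (2 * n - 1))) (hφ : Monotone φ) {n : ℤ} (hn : n ≤ 0)
    {j : ℕ → κ} (hj : ∀ k : ℕ, φ (j k) = 2 * (n - k) - 1) :
    ∃ f, IsBackwardChain (E := fun k : ℕ => F (2 * (n - k) - 2)) μ
      (reindex (naturalFiltration μ Z) φ hφ) j f
      (fun k x z => condProb μ (Z (2 * (n - k) - 2)) (Z (2 * (n - (k + 1 : ℕ)) - 1)) z x)
      fun k => Z (2 * (n - k) - 1) := by
  choose f hf using fun k : ℕ => (h.brick (n - k) (by omega)).eq_fun₀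
  refine ⟨f, fun k => ?_, fun k => ?_, fun k x => ?_⟩
  · exact h.measurable_naturalFiltration (hj k).ge (by omega)
  · change HasTransition μ (naturalFiltration μ Z (φ (j (k + 1)))) _ _ _
    rw [hj (k + 1)]
    exact (h.hasTransition_of_eq (n := n - (k + 1 : ℕ)) (by omega) rfl
      (by push_cast; ring)).congr_ae (ae_eq_refl _) (hf k)
  · rw [(h.brick (n - k) (by omega)).uniform₁ x]
    exact one_div_le_one_div_of_le two_pos (by exact_mod_cast hF _ (by omega))

theorem IsBrickChain.not_isStandard_reindex (h : IsBrickChain μ Z r α)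
    (hF : ∀ n ≤ 0, 2 ≤ Fintype.card (F (2 * n - 1))) (hα : ∀ n ≤ 0, 0 ≤ α n)
    (hsum : Summable fun n : Set.Iic (0 : ℤ) => α n) (hφ : StrictMono φ)
    (hfin : {n : ℤ | n ≤ 0 ∧ 2 * n - 1 ∉ Set.range φ}.Finite) :
    ¬ IsStandard μ (reindex (naturalFiltration μ Z) φ hφ.monotone) := by
  obtain ⟨N, hN⟩ := hfin.bddBelow
  have hsum' : Summable fun k : ℕ => α (-(k : ℤ)) :=
    hsum.comp_injective (i := fun k : ℕ => (⟨-(k : ℤ), by simp⟩ : Set.Iic (0 : ℤ)))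
      fun k l hkl => by simpa using hkl
  obtain ⟨M, hMN, hM⟩ := exists_sum_range_le hsum' (fun k => hα _ (by omega))
    (show (0 : ℝ) < 1 / 4 by norm_num) (N.natAbs + 2)
  have hrange : ∀ k : ℕ, ∃ i, φ i = 2 * (1 - (M : ℤ) - k) - 1 := by
    intro k
    by_contra hk
    have := hN (show 1 - (M : ℤ) - k ∈ _ from ⟨by omega, hk⟩)
    omega
  choose j hj using hrange
  have hjanti : Antitone j := fun k l hkl => by
    rw [← hφ.le_iff_le, hj, hj]
    omega
  obtain ⟨f, hchain⟩ := h.exists_isBackwardChain hF hφ.monotone (by omega) hj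
  refine hchain.not_isStandard hjanti (fun i => ⟨(-φ i).toNat, ?_⟩) (ε := fun k => α (-(k + M : ℕ)))
    (fun k => hα _ (by omega)) hM fun k x x' hx => ?_
  · rw [← hφ.lt_iff_lt, hj]
    omega
  · exact h.sum_min_condProb_le (by omega) (by push_cast; ring) (by push_cast; ring) hx

theorem IsBrickChain.isStandard_reindex_iff (h : IsBrickChain μ Z r α)
    (hF : ∀ n ≤ 0, 2 ≤ Fintype.card (F (2 * n - 1))) (hα : ∀ n ≤ 0, 0 ≤ α n)
    (hsum : Summable fun n : Set.Iic (0 : ℤ) => α n) (hφ : StrictMono φ) (hφ0 : ∀ d, φ d ≤ 0) :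
    IsStandard μ (reindex (naturalFiltration μ Z) φ hφ.monotone) ↔
      {n : ℤ | n ≤ 0 ∧ 2 * n - 1 ∉ Set.range φ}.Infinite :=
  ⟨fun hst hfin => h.not_isStandard_reindex hF hα hsum hφ hfin hst, h.isStandard_reindex hφ hφ0⟩

theorem IsBrickChain.isStandard_extract_iff (h : IsBrickChain μ Z r α)
    (hF : ∀ n ≤ 0, 2 ≤ Fintype.card (F (2 * n - 1))) (hα : ∀ n ≤ 0, 0 ≤ α n)
    (hsum : Summable fun n : Set.Iic (0 : ℤ) => α n) {D : Set ℤ} (hD : D ⊆ Set.Iic 0) :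
    IsStandard μ (extract (naturalFiltration μ Z) D) ↔
      {n : ℤ | n ≤ 0 ∧ 2 * n - 1 ∉ D}.Infinite := by
  have hiff := h.isStandard_reindex_iff hF hα hsum (Subtype.strictMono_coe (· ∈ D))
    fun d => hD d.2
  rwa [Subtype.range_coe_subtype, ofPred_mem_eq] at hiff

theorem strictMono_two_mul_sub_one : StrictMono fun n : Set.Iic (0 : ℤ) => 2 * (n : ℤ) - 1 :=
  fun a b (hab : (a : ℤ) < b) => show 2 * (a : ℤ) - 1 < 2 * b - 1 by omega

theorem image_coe_compl_eq (B : Set (Set.Iic (0 : ℤ))) : ((↑) : Set.Iic (0 : ℤ) → ℤ) '' Bᶜ =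
    {n : ℤ | n ≤ 0 ∧ 2 * n - 1 ∉ Set.range fun i : B => 2 * ((i : Set.Iic (0 : ℤ)) : ℤ) - 1} := by
  ext n
  constructor
  · rintro ⟨n, hn, rfl⟩
    refine ⟨n.2, fun ⟨i, hi⟩ => hn ?_⟩
    rw [← (strictMono_two_mul_sub_one.injective hi : (i : Set.Iic (0 : ℤ)) = n)]
    exact i.2
  · rintro ⟨hn, hnB⟩
    exact ⟨⟨n, hn⟩, fun hmem => hnB ⟨⟨_, hmem⟩, rfl⟩, rfl⟩

theorem IsBrickChain.atThreshold_oddTimes (h : IsBrickChain μ Z r α)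
    (hF : ∀ n ≤ 0, 2 ≤ Fintype.card (F (2 * n - 1))) (hα : ∀ n ≤ 0, 0 ≤ α n)
    (hsum : Summable fun n : Set.Iic (0 : ℤ) => α n) :
    AtThreshold μ (oddTimes (naturalFiltration μ Z)) := by
  refine ⟨h.not_isStandard_reindex hF hα hsum strictMono_two_mul_sub_one
    (Set.finite_empty.subset fun n hn => hn.2 ⟨⟨n, hn.1⟩, rfl⟩), fun B _ => ?_⟩
  rw [← Set.infinite_image_iff (s := Bᶜ) Subtype.val_injective.injOn, image_coe_compl_eq]
  exact h.isStandard_reindex_iff hF hα hsum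
    (strictMono_two_mul_sub_one.comp (Subtype.strictMono_coe (· ∈ B))) fun d => by
      have : ((d : Set.Iic (0 : ℤ)) : ℤ) ≤ 0 := d.1.2
      simp only [Function.comp_apply]
      omega

end Bricks

end BackwardFiltration

end

open BackwardFiltration in
theorem mainTheorem2 {Ω : Type*} [MeasurableSpace Ω] (μ : Measure Ω) [IsProbabilityMeasure μ]
    (F : ℤ → Type*) [∀ n, Fintype (F n)] [∀ n, MeasurableSpace (F n)]
    [∀ n, MeasurableSingletonClass (F n)]
    (Z : ∀ n, Ω → F n) (r : ℤ → ℕ) (α : ℤ → ℝ)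
    (hZ : ∀ n ≤ 0, Measurable (Z n))
    (hF : ∀ n ≤ 0, 2 ≤ Fintype.card (F n))
    (hα : ∀ n ≤ 0, α n ∈ Set.Ioo (0 : ℝ) 1)
    (hsum : Summable (fun n : Set.Iic (0 : ℤ) => α n))
    (hindep : iIndepFun (fun n : Set.Iic (0 : ℤ) => Z (2 * (n : ℤ))) μ)
    (hbrick : ∀ n ≤ 0, IsStrongBrick μ (Z (2 * n - 2)) (Z (2 * n - 1)) (Z (2 * n))
      (r (2 * n - 1)) (r (2 * n)) (α n)) :
    IsMarkov μ Z ∧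
    IsAdicFiltration μ (naturalFiltration μ Z) r ∧
    (∀ D : Set ℤ, D ⊆ Set.Iic 0 → D.Infinite →
      (IsStandard μ (extract (naturalFiltration μ Z) D) ↔
        {n : ℤ | n ≤ 0 ∧ 2 * n - 1 ∉ D}.Infinite)) ∧
    AtThreshold μ (oddTimes (naturalFiltration μ Z)) := by
  have h : IsBrickChain μ Z r α := ⟨hZ, hindep, hbrick⟩
  have hodd : ∀ n ≤ 0, 2 ≤ Fintype.card (F (2 * n - 1)) := fun n hn => hF _ (by omega)
  have hα0 : ∀ n ≤ 0, 0 ≤ α n := fun n hn => (hα n hn).1.le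
  exact ⟨h.isMarkov, h.isAdicFiltration,
    fun D hD _ => h.isStandard_extract_iff hodd hα0 hsum hD, h.atThreshold_oddTimes hodd hα0 hsum⟩
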